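/- There are an absolute constant $C>0$ and a function $\varepsilon$ with $\varepsilon(K)\to 0$ as $K\to\infty$ such that the following holds. Let $G$ be an Abelian group, let $K\ge 1$ be real, and let $A\subset G$ be a finite non-empty set with $|A+A|\le K|A|$. Then there is a finite set $X\subset G$ which is a symmetric neighbourhood of the identity (that is, $X=-X$ and $0_G\in X$) such that 1. $A$ is $\exp\bigl(C(\log(2+K))^{3+\varepsilon(K)}\bigr)$-covered by $X$, i.e. there is a set $T\subset G$ with $|T|\le \exp\bigl(C(\log(2+K))^{3+\varepsilon(K)}\bigr)$ and $A\subset T+X$; 2. $|X|\le \exp\bigl(C(\log(2+K))^{1+\varepsilon(K)}\bigr)\,|A|$; 3. $X$ has relative polynomial growth of order $d:=C(\log(2+K))^{3+\varepsilon(K)}$, i.e. $|nX|\le n^{d}|X|$ for every integer $n\ge 1$, where $nX=X+\dots+X$ ($n$ summands). -/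

import Mathlib

open Filter Topology
open scoped Pointwise

namespace SetAddition

variable {G : Type*} [AddCommGroup G] [DecidableEq G]

/-- The `n`-fold sumset `nX = X + ⋯ + X` (with `0X = {0}`); this is not the dilate of `X`. -/
def iterSum : ℕ → Finset G → Finset G
  | 0, _ => {0}
  | n + 1, X => iterSum n X + X

/-- `A` is `k`-covered by `B`: there is a set `T` of size at most `k` with `A ⊆ T + B`. -/
def IsCoveredBy (k : ℝ) (A B : Finset G) : Prop :=
  ∃ T : Finset G, (T.card : ℝ) ≤ k ∧ A ⊆ T + B

/-- Symmetric neighbourhood of the identity. -/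
def IsSymmNhd (X : Finset G) : Prop :=
  -X = X ∧ (0 : G) ∈ X

/-- Relative polynomial growth of order `d`: `|nX| ≤ n ^ d * |X|` for all positive integers `n`. -/
def HasRelPolyGrowth (d : ℝ) (X : Finset G) : Prop :=
  ∀ n : ℕ, 1 ≤ n → ((iterSum n X).card : ℝ) ≤ (n : ℝ) ^ d * (X.card : ℝ)

end SetAddition

set_option linter.unusedSectionVars false

namespace SetAddition

variable {G : Type*} [AddCommGroup G] [DecidableEq G]

theorem iterSum_eq_nsmul (n : ℕ) (X : Finset G) : iterSum n X = n • X := by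
  induction n with
  | zero => simp [iterSum, Finset.singleton_zero]
  | succ n ih => rw [iterSum, ih, succ_nsmul]

theorem zero_mem_nsmul {X : Finset G} (h : (0 : G) ∈ X) (n : ℕ) : (0 : G) ∈ n • X := by
  simpa using Finset.nsmul_mem_nsmul (n := n) h

theorem neg_nsmul_eq {X : Finset G} (h : -X = X) (n : ℕ) : -(n • X) = n • X := by
  induction n with
  | zero => simp
  | succ n ih => rw [succ_nsmul, neg_add, ih, h]

theorem nsmul_subset_nsmul_of_le {X : Finset G} (h : (0 : G) ∈ X) {m n : ℕ} (hmn : m ≤ n) :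
    m • X ⊆ n • X :=
  Finset.nsmul_subset_nsmul_right h hmn

theorem subset_add_of_zero_mem (X : Finset G) {Y : Finset G} (h : (0 : G) ∈ Y) : X ⊆ X + Y :=
  fun x hx => Finset.mem_add.2 ⟨x, hx, 0, h, add_zero x⟩

theorem neg_sub_self (X : Finset G) : -(X - X) = X - X := by
  rw [neg_sub]

/-- The sums `∑ εᵢ tᵢ` with `εᵢ ∈ {-1, 0, 1}` over a list of elements `tᵢ`. -/
def spanList : List G → Finset G
  | [] => {0}
  | t :: l => spanList l + {-t, 0, t}

/-- The sums `∑ εᵢ tᵢ` with `εᵢ ∈ {0, 1}` over a list of elements `tᵢ`. -/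
def cubeList : List G → Finset G
  | [] => {0}
  | t :: l => cubeList l + {0, t}

theorem cubeList_sub_cubeList_subset (l : List G) :
    cubeList l - cubeList l ⊆ spanList l := by
  induction l with
  | nil => simp [spanList, cubeList]
  | cons t l ih =>
    rw [cubeList, spanList, add_sub_add_comm]
    refine Finset.add_subset_add ih ?_
    intro x hx
    simp only [Finset.mem_sub, Finset.mem_insert, Finset.mem_singleton] at hx ⊢
    rcases hx with ⟨y, rfl | rfl, z, rfl | rfl, rfl⟩ <;> simp

theorem cubeList_subset_nsmul {Y : Finset G} (h0 : (0 : G) ∈ Y) {l : List G}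
    (hl : ∀ t ∈ l, t ∈ Y) : cubeList l ⊆ l.length • Y := by
  induction l with
  | nil => simp [cubeList]
  | cons t l ih =>
    rw [cubeList, List.length_cons, succ_nsmul]
    refine Finset.add_subset_add (ih fun s hs => hl s (List.mem_cons_of_mem _ hs)) ?_
    intro x hx
    simp only [Finset.mem_insert, Finset.mem_singleton] at hx
    rcases hx with rfl | rfl
    · exact h0
    · exact hl _ (by simp)

theorem card_nsmul_spanList_le (n : ℕ) (l : List G) :
    (n • spanList l).card ≤ (2 * n + 1) ^ l.length := by
  induction l with
  | nil => simp [spanList, Finset.singleton_zero]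
  | cons t l ih =>
    have hsub : ∀ k : ℕ, k • ({-t, 0, t} : Finset G) ⊆
        (Finset.Icc (-(k : ℤ)) k).image (fun z => z • t) := by
      intro k
      induction k with
      | zero => simp [Finset.singleton_zero]
      | succ k ihk =>
        rw [succ_nsmul]
        intro x hx
        obtain ⟨y, hy, z, hz, rfl⟩ := Finset.mem_add.1 hx
        obtain ⟨a, ha, rfl⟩ := Finset.mem_image.1 (ihk hy)
        rw [Finset.mem_Icc] at ha
        simp only [Finset.mem_insert, Finset.mem_singleton] at hz
        rw [Finset.mem_image]
        rcases hz with rfl | rfl | rfl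
        · exact ⟨a - 1, by rw [Finset.mem_Icc]; push_cast; omega, by rw [sub_smul, one_smul]; abel⟩
        · exact ⟨a, by rw [Finset.mem_Icc]; push_cast; omega, by simp⟩
        · exact ⟨a + 1, by rw [Finset.mem_Icc]; push_cast; omega, by rw [add_smul, one_smul]⟩
    have hcard : (n • ({-t, 0, t} : Finset G)).card ≤ 2 * n + 1 := by
      refine (Finset.card_le_card (hsub n)).trans (Finset.card_image_le.trans ?_)
      rw [Int.card_Icc]
      omega
    rw [spanList, nsmul_add, List.length_cons, pow_succ]
    exact Finset.card_add_le.trans (Nat.mul_le_mul ih hcard)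

/-- Chang's covering lemma at a single scale. -/
theorem exists_list_subset_add_spanList {X Y : Finset G} (h0 : (0 : G) ∈ Y) {d : ℕ}
    (h : (X + d • Y).card < 2 ^ d * X.card) :
    ∃ l : List G, l.length ≤ d ∧ Y ⊆ X - X + spanList l := by
  by_contra! hcon
  have key : ∀ k ≤ d, ∃ l : List G, l.length = k ∧ (∀ t ∈ l, t ∈ Y) ∧
      2 ^ k * X.card ≤ (X + cubeList l).card := by
    intro k
    induction k with
    | zero => exact fun _ => ⟨[], rfl, by simp, by simp [cubeList, Finset.singleton_zero]⟩
    | succ k ih =>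
      intro hk
      obtain ⟨l, hl, hlY, hc⟩ := ih (by omega)
      obtain ⟨t, htY, ht⟩ := Finset.not_subset.1 (hcon l (by omega))
      refine ⟨t :: l, by simp [hl], by simpa using ⟨htY, hlY⟩, ?_⟩
      have hdisj : Disjoint (X + cubeList l) ((X + cubeList l) + {t}) := by
        rw [Finset.disjoint_left]
        intro z hz hz'
        obtain ⟨x, hx, c, hcm, rfl⟩ := Finset.mem_add.1 hz
        obtain ⟨w, hw, t', ht', he⟩ := Finset.mem_add.1 hz'
        obtain ⟨x', hx', c', hc', rfl⟩ := Finset.mem_add.1 hw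
        rw [Finset.mem_singleton] at ht'
        subst ht'
        apply ht
        refine Finset.mem_add.2 ⟨x - x', Finset.sub_mem_sub hx hx', c - c',
          cubeList_sub_cubeList_subset l (Finset.sub_mem_sub hcm hc'), ?_⟩
        have : t' = x + c - (x' + c') := by rw [← he]; abel
        rw [this]; abel
      have heq : X + cubeList (t :: l) = (X + cubeList l) ∪ ((X + cubeList l) + {t}) := by
        rw [cubeList, ← add_assoc, show ({0, t} : Finset G) = {0} ∪ {t} from rfl, Finset.add_union,
          Finset.singleton_zero, add_zero]
      rw [heq, Finset.card_union_of_disjoint hdisj, Finset.card_add_singleton, pow_succ]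
      linarith
  obtain ⟨l, hl, hlY, hc⟩ := key d le_rfl
  have h1 : (X + cubeList l).card ≤ (X + d • Y).card :=
    Finset.card_le_card (Finset.add_subset_add_left (hl ▸ cubeList_subset_nsmul h0 hlY))
  omega

/-- A set that grows by a constant factor only when each summand is enlarged by a span keeps
doing so for all multiples. -/
theorem nsmul_subset_nsmul_add {Y S : Finset G} (h : Y + Y ⊆ S + Y) (n : ℕ) :
    (n + 1) • Y ⊆ n • S + Y := by
  induction n with
  | zero => simp
  | succ n ih =>
    rw [succ_nsmul, succ_nsmul S, add_assoc]
    refine (Finset.add_subset_add_right ih).trans ?_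
    rw [add_assoc]
    exact Finset.add_subset_add_left h

/-- Small growth at a single scale implies relative polynomial growth. -/
theorem hasRelPolyGrowth_of_card_lt {X : Finset G} (hX : IsSymmNhd X) {d : ℕ} (hd : 1 ≤ d)
    (h : ((3 * d + 1) • X).card < 2 ^ d * X.card) {D : ℝ} (hD : 4 * (d : ℝ) ≤ D) :
    HasRelPolyGrowth D X := by
  obtain ⟨hs, h0⟩ := hX
  obtain ⟨l, hl, hlY⟩ := exists_list_subset_add_spanList (X := X) (Y := 3 • X)
    (zero_mem_nsmul h0 3) (d := d) (by
      have : X + d • 3 • X = (3 * d + 1) • X := by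
        rw [← mul_nsmul, succ_nsmul']
      rwa [this])
  have hXX : X - X = 2 • X := by rw [sub_eq_add_neg, hs, two_nsmul]
  rw [hXX] at hlY
  have hgrow : ∀ n : ℕ, (n + 2) • X ⊆ n • spanList l + 2 • X := by
    intro n
    induction n with
    | zero => simp
    | succ n ih =>
      calc (n + 1 + 2) • X = (n + 2) • X + X := by rw [← succ_nsmul]
        _ ⊆ n • spanList l + 2 • X + X := Finset.add_subset_add_right ih
        _ = n • spanList l + 3 • X := by rw [add_assoc, ← succ_nsmul]
        _ ⊆ n • spanList l + (2 • X + spanList l) := Finset.add_subset_add_left hlY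
        _ = (n + 1) • spanList l + 2 • X := by
          rw [add_comm (2 • X), ← add_assoc, ← succ_nsmul]
  have h2 : (2 • X).card ≤ 2 ^ d * X.card :=
    (Finset.card_le_card (nsmul_subset_nsmul_of_le h0 (by omega))).trans h.le
  intro n hn
  rw [iterSum_eq_nsmul]
  rcases Nat.lt_or_ge n 2 with h' | h'
  · obtain rfl : n = 1 := by omega
    simp
  · obtain ⟨m, rfl⟩ : ∃ m, n = m + 2 := ⟨n - 2, by omega⟩
    have hc : ((m + 2) • X).card ≤ (2 * m + 1) ^ d * (2 ^ d * X.card) := by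
      refine (Finset.card_le_card (hgrow m)).trans (Finset.card_add_le.trans ?_)
      refine Nat.mul_le_mul ((card_nsmul_spanList_le m l).trans ?_) h2
      exact Nat.pow_le_pow_right (by omega) hl
    have hc2 : ((m + 2) • X).card ≤ (m + 2) ^ (4 * d) * X.card := by
      refine hc.trans ?_
      rw [← mul_assoc, ← mul_pow, pow_mul]
      refine Nat.mul_le_mul_right _ (Nat.pow_le_pow_left ?_ d)
      calc (2 * m + 1) * 2 ≤ m ^ 4 + 8 * m ^ 3 + 24 * m ^ 2 + 32 * m + 16 := by
            have := Nat.zero_le (m ^ 4 + 8 * m ^ 3 + 24 * m ^ 2)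
            omega
        _ = (m + 2) ^ 4 := by ring
    have hc3 : (((m + 2) • X).card : ℝ) ≤ ((m + 2 : ℕ) : ℝ) ^ (4 * d) * X.card := by
      exact_mod_cast hc2
    refine hc3.trans ?_
    refine mul_le_mul_of_nonneg_right ?_ (Nat.cast_nonneg _)
    rw [← Real.rpow_natCast]
    refine Real.rpow_le_rpow_of_exponent_le ?_ (by push_cast; exact hD)
    push_cast
    linarith [Nat.cast_nonneg (α := ℝ) m]

end SetAddition

namespace SetAddition

variable {G : Type*} [AddCommGroup G] [DecidableEq G]

/-- A one-sided Hoeffding bound for sampling with replacement from a finite set. -/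
theorem card_filter_sum_gt_le {β : Type*} (B : Finset β) (g : β → ℝ)
    (hg : ∀ b ∈ B, |g b| ≤ 1) (h0 : ∑ b ∈ B, g b = 0) (l : ℕ) {ε : ℝ} (hε : 0 ≤ ε) (hε2 : ε ≤ 2) :
    (((Fintype.piFinset fun _ : Fin l => B).filter fun z => ε * l < ∑ i, g (z i)).card : ℝ) ≤
      Real.exp (-(ε ^ 2 * l / 4)) * (B.card : ℝ) ^ l := by
  set Z := Fintype.piFinset fun _ : Fin l => B
  have hmgf : ∑ z ∈ Z, Real.exp (ε / 2 * ∑ i, g (z i)) ≤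
      (Real.exp ((ε / 2) ^ 2) * B.card) ^ l := by
    have h1 : ∑ z ∈ Z, Real.exp (ε / 2 * ∑ i, g (z i)) =
        (∑ b ∈ B, Real.exp (ε / 2 * g b)) ^ l := by
      have := Finset.prod_univ_sum (fun _ : Fin l => B) (fun _ b => Real.exp (ε / 2 * g b))
      simp only [Finset.prod_const, Finset.card_univ, Fintype.card_fin] at this
      rw [this]
      refine Finset.sum_congr rfl fun z _ => ?_
      rw [← Real.exp_sum, Finset.mul_sum]
    rw [h1]
    refine pow_le_pow_left₀ (Finset.sum_nonneg fun b _ => (Real.exp_pos _).le) ?_ l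
    calc ∑ b ∈ B, Real.exp (ε / 2 * g b) ≤ ∑ b ∈ B, (1 + (ε / 2) ^ 2 + ε / 2 * g b) := by
          refine Finset.sum_le_sum fun b hb => ?_
          have hb1 := hg b hb
          have hy : |ε / 2 * g b| ≤ 1 := by
            rw [abs_mul, abs_of_nonneg (by linarith : (0 : ℝ) ≤ ε / 2)]
            nlinarith [abs_nonneg (g b)]
          have h2 := (abs_le.1 (Real.abs_exp_sub_one_sub_id_le hy)).2
          have h3 : (ε / 2 * g b) ^ 2 ≤ (ε / 2) ^ 2 := by
            rw [mul_pow]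
            have : g b ^ 2 ≤ 1 := (sq_le_one_iff_abs_le_one _).2 hb1
            nlinarith [sq_nonneg (ε / 2)]
          linarith
      _ = (1 + (ε / 2) ^ 2) * B.card := by
          rw [Finset.sum_add_distrib, ← Finset.mul_sum, h0, Finset.sum_const, nsmul_eq_mul]
          ring
      _ ≤ Real.exp ((ε / 2) ^ 2) * B.card := by
          refine mul_le_mul_of_nonneg_right ?_ (Nat.cast_nonneg _)
          rw [add_comm]
          exact Real.add_one_le_exp _
  have h2 : ((Z.filter fun z => ε * l < ∑ i, g (z i)).card : ℝ) * Real.exp (ε / 2 * (ε * l)) ≤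
      ∑ z ∈ Z, Real.exp (ε / 2 * ∑ i, g (z i)) := by
    rw [← nsmul_eq_mul, ← Finset.sum_const]
    refine (Finset.sum_le_sum fun z hz => ?_).trans
      (Finset.sum_le_sum_of_subset_of_nonneg (Finset.filter_subset _ Z)
        fun z _ _ => (Real.exp_pos _).le)
    rw [Finset.mem_filter] at hz
    exact Real.exp_le_exp.2 (mul_le_mul_of_nonneg_left hz.2.le (by linarith))
  have h3 := h2.trans hmgf
  rw [mul_pow, ← Real.exp_nat_mul, ← le_div_iff₀ (Real.exp_pos _), mul_div_right_comm,
    ← Real.exp_sub] at h3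
  refine h3.trans_eq ?_
  congr 2
  ring

theorem card_filter_abs_sum_gt_le {β : Type*} (B : Finset β) (g : β → ℝ)
    (hg : ∀ b ∈ B, |g b| ≤ 1) (h0 : ∑ b ∈ B, g b = 0) (l : ℕ) {ε : ℝ} (hε : 0 ≤ ε) (hε2 : ε ≤ 2) :
    (((Fintype.piFinset fun _ : Fin l => B).filter fun z => ε * l < |∑ i, g (z i)|).card : ℝ) ≤
      2 * Real.exp (-(ε ^ 2 * l / 4)) * (B.card : ℝ) ^ l := by
  classical
  have h1 := card_filter_sum_gt_le B g hg h0 l hε hε2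
  have h2 := card_filter_sum_gt_le B (fun b => -g b) (by simpa using hg) (by simpa using h0) l hε hε2
  have h3 : ((Fintype.piFinset fun _ : Fin l => B).filter fun z => ε * l < |∑ i, g (z i)|) ⊆
      ((Fintype.piFinset fun _ : Fin l => B).filter fun z => ε * l < ∑ i, g (z i)) ∪
      ((Fintype.piFinset fun _ : Fin l => B).filter fun z => ε * l < ∑ i, -g (z i)) := by
    intro z hz
    simp only [Finset.mem_union, Finset.mem_filter] at hz ⊢
    rw [Finset.sum_neg_distrib]
    rcases lt_abs.1 hz.2 with h | h
    · exact Or.inl ⟨hz.1, h⟩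
    · exact Or.inr ⟨hz.1, h⟩
  have h4 := (Nat.cast_le (α := ℝ)).2 ((Finset.card_le_card h3).trans (Finset.card_union_le _ _))
  push_cast at h4
  linarith

/-- The proportion of `b ∈ B` with `x + b ∈ C`. -/
noncomputable def avg (B C : Finset G) (x : G) : ℝ :=
  (∑ b ∈ B, if x + b ∈ C then (1 : ℝ) else 0) / B.card

/-- The proportion of entries `z i` of the tuple `z` with `x + z i ∈ C`. -/
noncomputable def tupleAvg {l : ℕ} (z : Fin l → G) (C : Finset G) (x : G) : ℝ :=
  (∑ i, if x + z i ∈ C then (1 : ℝ) else 0) / l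

theorem avg_mem_Icc (B C : Finset G) (x : G) : 0 ≤ avg B C x ∧ avg B C x ≤ 1 := by
  constructor
  · refine div_nonneg (Finset.sum_nonneg fun b _ => ?_) (Nat.cast_nonneg _)
    split_ifs <;> norm_num
  · refine div_le_one_of_le₀ ?_ (Nat.cast_nonneg _)
    calc _ ≤ ∑ b ∈ B, (1 : ℝ) := Finset.sum_le_sum fun b _ => by split_ifs <;> norm_num
      _ = B.card := by simp

theorem card_filter_abs_tupleAvg_sub_avg_gt_le {B : Finset G} (hB : B.Nonempty) (C : Finset G)
    (x : G) {l : ℕ} (hl : 1 ≤ l) {ε : ℝ} (hε : 0 ≤ ε) (hε2 : ε ≤ 2) :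
    (((Fintype.piFinset fun _ : Fin l => B).filter
      fun z => ε < |tupleAvg z C x - avg B C x|).card : ℝ) ≤
      2 * Real.exp (-(ε ^ 2 * l / 4)) * (B.card : ℝ) ^ l := by
  have hB0 : (B.card : ℝ) ≠ 0 := by exact_mod_cast hB.card_ne_zero
  have hl0 : (0 : ℝ) < l := by exact_mod_cast hl
  have hm := avg_mem_Icc B C x
  refine le_trans ?_ (card_filter_abs_sum_gt_le B
    (fun b => (if x + b ∈ C then (1 : ℝ) else 0) - avg B C x) ?_ ?_ l hε hε2)
  · refine le_of_eq ?_
    congr 2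
    refine Finset.filter_congr fun z _ => ?_
    rw [Finset.sum_sub_distrib, Finset.sum_const, Finset.card_univ, Fintype.card_fin, nsmul_eq_mul]
    have : (∑ i, if x + z i ∈ C then (1 : ℝ) else 0) - l * avg B C x =
        (tupleAvg z C x - avg B C x) * l := by
      rw [tupleAvg]; field_simp
    rw [this, abs_mul, abs_of_pos hl0, mul_lt_mul_iff_left₀ hl0]
  · intro b _
    rw [abs_le]
    constructor <;> split_ifs <;> linarith [hm.1, hm.2]
  · rw [Finset.sum_sub_distrib, Finset.sum_const, nsmul_eq_mul, avg]
    field_simp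
    ring

/-- The set of points of `C - B` where the tuple `z` samples `C` badly. -/
noncomputable def badSet {l : ℕ} (B C : Finset G) (ε : ℝ) (z : Fin l → G) : Finset G :=
  (C - B).filter fun x => ε < |tupleAvg z C x - avg B C x|

theorem abs_tupleAvg_sub_avg_le {l : ℕ} {B C : Finset G} {ε : ℝ} (hε : 0 ≤ ε) {z : Fin l → G}
    (hz : ∀ i, z i ∈ B) {x : G} (hx : x ∉ badSet B C ε z) :
    |tupleAvg z C x - avg B C x| ≤ ε := by
  by_cases h : x ∈ C - B
  · by_contra! h'
    exact hx (Finset.mem_filter.2 ⟨h, h'⟩)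
  · have hb : ∀ b ∈ B, x + b ∉ C := fun b hb hc =>
      h (Finset.mem_sub.2 ⟨x + b, hc, b, hb, add_sub_cancel_right x b⟩)
    have h1 : tupleAvg z C x = 0 := by
      rw [tupleAvg, Finset.sum_eq_zero fun i _ => if_neg (hb _ (hz i)), zero_div]
    have h2 : avg B C x = 0 := by
      rw [avg, Finset.sum_eq_zero fun b hb' => if_neg (hb b hb'), zero_div]
    rw [h1, h2]
    simpa using hε

/-- At least half of all tuples sample `C` well. -/
theorem card_good_tuples_ge {B C : Finset G} (hB : B.Nonempty) (hC : C.Nonempty) {l : ℕ}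
    (hl : 1 ≤ l) {ε : ℝ} (hε : 0 ≤ ε) (hε2 : ε ≤ 2) :
    (B.card : ℝ) ^ l ≤ 2 * ((Fintype.piFinset fun _ : Fin l => B).filter fun z =>
      ((badSet B C ε z).card : ℝ) ≤ 4 * Real.exp (-(ε ^ 2 * l / 4)) * (C - B).card).card := by
  set Z := Fintype.piFinset fun _ : Fin l => B with hZ
  set e := Real.exp (-(ε ^ 2 * l / 4))
  have he : 0 < e := Real.exp_pos _
  have hQ : (0 : ℝ) < (C - B).card := by exact_mod_cast (hC.sub hB).card_pos
  have hsum : ∑ z ∈ Z, ((badSet B C ε z).card : ℝ) ≤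
      (C - B).card * (2 * e * (B.card : ℝ) ^ l) := by
    have h1 : ∑ z ∈ Z, ((badSet B C ε z).card : ℝ) =
        ∑ x ∈ C - B, ((Z.filter fun z => ε < |tupleAvg z C x - avg B C x|).card : ℝ) := by
      simp only [badSet, Finset.card_filter, Nat.cast_sum]
      exact Finset.sum_comm
    rw [h1, ← nsmul_eq_mul, ← Finset.sum_const]
    exact Finset.sum_le_sum fun x _ =>
      card_filter_abs_tupleAvg_sub_avg_gt_le hB C x hl hε hε2
  have hbad : ((Z.filter fun z => ¬ ((badSet B C ε z).card : ℝ) ≤ 4 * e * (C - B).card).card : ℝ) *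
      (4 * e * (C - B).card) ≤ ∑ z ∈ Z, ((badSet B C ε z).card : ℝ) := by
    rw [← nsmul_eq_mul, ← Finset.sum_const]
    refine (Finset.sum_le_sum fun z hz => ?_).trans
      (Finset.sum_le_sum_of_subset_of_nonneg (Finset.filter_subset _ Z)
        fun z _ _ => Nat.cast_nonneg _)
    exact (not_le.1 (Finset.mem_filter.1 hz).2).le
  have hcard : (Z.card : ℝ) = (B.card : ℝ) ^ l := by
    rw [hZ, Fintype.card_piFinset]
    simp
  have hsplit := Finset.card_filter_add_card_filter_not (s := Z)
    (fun z => ((badSet B C ε z).card : ℝ) ≤ 4 * e * (C - B).card)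
  have hsplit' := congrArg (Nat.cast (R := ℝ)) hsplit
  push_cast at hsplit'
  rw [hcard] at hsplit'
  have h3 := hbad.trans hsum
  have h4 : (2 * ((Z.filter fun z =>
      ¬ ((badSet B C ε z).card : ℝ) ≤ 4 * e * (C - B).card).card : ℝ)) *
      (2 * e * (C - B).card) ≤ (B.card : ℝ) ^ l * (2 * e * (C - B).card) := by linarith
  have h5 := le_of_mul_le_mul_right h4 (by positivity)
  linarith

/-- `t` moves the values of `f` by at most `e` outside a set of size at most `N`. -/
def IsAlmostPeriod (f : G → ℝ) (e N : ℝ) (t : G) : Prop :=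
  ∃ E : Finset G, (E.card : ℝ) ≤ N ∧ ∀ y ∉ E, |f (y + t) - f y| ≤ e

theorem IsAlmostPeriod.add {f : G → ℝ} {e e' N N' : ℝ} {t t' : G} (h : IsAlmostPeriod f e N t)
    (h' : IsAlmostPeriod f e' N' t') : IsAlmostPeriod f (e + e') (N + N') (t + t') := by
  obtain ⟨E, hE, hf⟩ := h
  obtain ⟨E', hE', hf'⟩ := h'
  refine ⟨E ∪ (E' - {t}), ?_, fun y hy => ?_⟩
  · have h1 := (Nat.cast_le (α := ℝ)).2 (Finset.card_union_le E (E' - {t}))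
    have h2 := (Nat.cast_le (α := ℝ)).2 (Finset.card_sub_le (s := E') (t := {t}))
    rw [Finset.card_singleton, mul_one] at h2
    push_cast at h1
    linarith
  · rw [Finset.mem_union, not_or] at hy
    have h1 := hf y hy.1
    have h2 := hf' (y + t) fun hmem =>
      hy.2 (Finset.mem_sub.2 ⟨y + t, hmem, t, Finset.mem_singleton_self t, by abel⟩)
    calc |f (y + (t + t')) - f y| = |(f (y + t) - f y) + (f (y + t + t') - f (y + t))| := by
          rw [← add_assoc]; congr 1; ring
      _ ≤ e + e' := (abs_add_le _ _).trans (add_le_add h1 h2)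

theorem isAlmostPeriod_of_mem_nsmul {f : G → ℝ} {e N : ℝ} {T : Finset G}
    (h : ∀ t ∈ T, IsAlmostPeriod f e N t) (k : ℕ) :
    ∀ t ∈ k • T, IsAlmostPeriod f (k * e) (k * N) t := by
  induction k with
  | zero => intro t ht
            simp only [zero_nsmul, Finset.mem_zero] at ht
            subst ht
            exact ⟨∅, by simp, by simp⟩
  | succ k ih =>
    intro t ht
    rw [succ_nsmul] at ht
    obtain ⟨a, ha, b, hb, rfl⟩ := Finset.mem_add.1 ht
    have := (ih a ha).add (h b hb)
    push_cast
    rwa [add_one_mul, add_one_mul]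

/-- Croot–Sisask: a large subset of `S` whose differences are almost periods of `avg B C`. -/
theorem exists_almostPeriods {B C S : Finset G} (hB : B.Nonempty) (hC : C.Nonempty)
    {l : ℕ} (hl : 1 ≤ l) {ε : ℝ} (hε : 0 ≤ ε) (hε2 : ε ≤ 2) :
    ∃ T ⊆ S, (S.card : ℝ) * (B.card : ℝ) ^ l ≤ 2 * ((B + S).card : ℝ) ^ l * T.card ∧
      ∀ t ∈ T - T, IsAlmostPeriod (avg B C) (2 * ε)
        (8 * Real.exp (-(ε ^ 2 * l / 4)) * (C - B).card) t := by
  rcases S.eq_empty_or_nonempty with rfl | hS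
  · exact ⟨∅, by simp⟩
  have hgood := card_good_tuples_ge hB hC hl hε hε2
  set e := Real.exp (-(ε ^ 2 * l / 4))
  set Z := (Fintype.piFinset fun _ : Fin l => B).filter fun z =>
      ((badSet B C ε z).card : ℝ) ≤ 4 * e * (C - B).card with hZ
  set W := Fintype.piFinset fun _ : Fin l => B + S with hW
  have hWcard : (W.card : ℝ) = ((B + S).card : ℝ) ^ l := by
    rw [hW, Fintype.card_piFinset]; simp
  have hWpos : (0 : ℝ) < W.card := by
    rw [hWcard]
    have : (0 : ℝ) < (B + S).card := by exact_mod_cast (hB.add hS).card_pos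
    positivity
  have hmaps : ∀ p ∈ Z ×ˢ S, (fun i => p.1 i + p.2) ∈ W := by
    intro p hp
    rw [Finset.mem_product, hZ, Finset.mem_filter, Fintype.mem_piFinset] at hp
    rw [hW, Fintype.mem_piFinset]
    exact fun i => Finset.add_mem_add (hp.1.1 i) hp.2
  obtain ⟨w, hw, hfib⟩ := Finset.exists_le_card_fiber_of_nsmul_le_card_of_maps_to (M := ℝ)
    (b := (Z.card : ℝ) * S.card / W.card) hmaps
    (Finset.card_pos.1 (by exact_mod_cast hWpos)) (by
      rw [Finset.card_product, nsmul_eq_mul, mul_div_cancel₀ _ hWpos.ne']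
      push_cast; exact le_rfl)
  refine ⟨S.filter fun s => (fun i => w i - s) ∈ Z, Finset.filter_subset _ _, ?_, ?_⟩
  · have hle : (((Z ×ˢ S).filter fun p => (fun i => p.1 i + p.2) = w).card : ℝ) ≤
        (S.filter fun s => (fun i => w i - s) ∈ Z).card := by
      norm_cast
      refine Finset.card_le_card_of_injOn Prod.snd ?_ ?_
      · intro p hp
        simp only [Finset.coe_filter, Finset.mem_product, Set.mem_ofPred_eq] at hp
        have : (fun i => w i - p.2) = p.1 := by
          ext i; rw [← hp.2]; simp
        simp only [Finset.coe_filter, Set.mem_ofPred_eq, this]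
        exact ⟨hp.1.2, hp.1.1⟩
      · intro p hp p' hp' h
        simp only [Finset.coe_filter, Finset.mem_product, Set.mem_ofPred_eq] at hp hp'
        refine Prod.ext (funext fun i => ?_) h
        have h1 := congrFun (hp.2.trans hp'.2.symm) i
        simp only [h] at h1
        exact add_right_cancel h1
    have h1 := hfib.trans hle
    rw [div_le_iff₀ hWpos, hWcard] at h1
    have h2 := mul_le_mul_of_nonneg_left hgood (Nat.cast_nonneg (α := ℝ) S.card)
    nlinarith
  · intro t ht
    obtain ⟨s, hs, s', hs', rfl⟩ := Finset.mem_sub.1 ht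
    rw [Finset.mem_filter] at hs hs'
    have hz := (Finset.mem_filter.1 hs.2)
    have hz' := (Finset.mem_filter.1 hs'.2)
    rw [Fintype.mem_piFinset] at hz hz'
    refine ⟨(badSet B C ε (fun i => w i - s) - {s - s'}) ∪ badSet B C ε (fun i => w i - s'),
      ?_, fun y hy => ?_⟩
    · have h1 := (Nat.cast_le (α := ℝ)).2 (Finset.card_union_le
        (badSet B C ε (fun i => w i - s) - {s - s'}) (badSet B C ε (fun i => w i - s')))
      have h2 := (Nat.cast_le (α := ℝ)).2 (Finset.card_sub_le
        (s := badSet B C ε (fun i => w i - s)) (t := {s - s'}))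
      rw [Finset.card_singleton, mul_one] at h2
      push_cast at h1
      linarith [hz.2, hz'.2]
    · rw [Finset.mem_union, not_or] at hy
      have h1 := abs_tupleAvg_sub_avg_le hε hz'.1 hy.2
      have h2 := abs_tupleAvg_sub_avg_le hε hz.1 (x := y + (s - s')) fun hmem =>
        hy.1 (Finset.mem_sub.2 ⟨_, hmem, _, Finset.mem_singleton_self _, by abel⟩)
      have h3 : tupleAvg (fun i => w i - s) C (y + (s - s')) =
          tupleAvg (fun i => w i - s') C y := by
        unfold tupleAvg
        congr 1
        refine Finset.sum_congr rfl fun i _ => ?_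
        rw [show y + (s - s') + (w i - s) = y + (w i - s') by abel]
      rw [h3, abs_le] at h2
      rw [abs_le] at h1 ⊢
      constructor <;> linarith [h1.1, h1.2, h2.1, h2.2]

/-- Croot–Sisask, in the form of a large set `T` with `k(T - T)` inside a bounded sumset. -/
theorem exists_nsmul_sub_subset {A B S : Finset G} (hA : A.Nonempty) (hB : B.Nonempty)
    {k l : ℕ} (hk : 1 ≤ k) (hl : 1 ≤ l)
    (h : 8 * k * Real.exp (-((l : ℝ) / (64 * k ^ 2))) * (A + B - B).card < A.card) :
    ∃ T ⊆ S, (S.card : ℝ) * (B.card : ℝ) ^ l ≤ 2 * ((B + S).card : ℝ) ^ l * T.card ∧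
      k • (T - T) ⊆ A + B - A - B := by
  have hk0 : (1 : ℝ) ≤ k := by exact_mod_cast hk
  have hkne : (k : ℝ) ≠ 0 := by positivity
  obtain ⟨T, hTS, hcard, hT⟩ := exists_almostPeriods (S := S) hB (hA.add hB) hl
    (ε := 1 / (4 * k)) (by positivity) (by rw [div_le_iff₀ (by positivity)]; linarith)
  refine ⟨T, hTS, hcard, fun t ht => ?_⟩
  obtain ⟨E, hE, hf⟩ := isAlmostPeriod_of_mem_nsmul hT k t ht
  have h1 : (1 / (4 * (k : ℝ))) ^ 2 * l / 4 = l / (64 * k ^ 2) := by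
    field_simp; norm_num
  have h2 : (k : ℝ) * (2 * (1 / (4 * k))) = 1 / 2 := by
    field_simp; norm_num
  rw [h1] at hE
  rw [h2] at hf
  have hEA : E.card < A.card := by
    have : (E.card : ℝ) < A.card := by linarith
    exact_mod_cast this
  obtain ⟨a, haA, haE⟩ := Finset.exists_mem_notMem_of_card_lt_card hEA
  have h3 := hf a haE
  have h4 : avg B (A + B) a = 1 := by
    rw [avg, Finset.sum_congr rfl fun b hb => if_pos (Finset.add_mem_add haA hb)]
    have : (B.card : ℝ) ≠ 0 := by exact_mod_cast hB.card_ne_zero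
    simp [this]
  rw [h4, abs_le] at h3
  have h5 : avg B (A + B) (a + t) ≠ 0 := by linarith [h3.1]
  rw [avg, div_ne_zero_iff] at h5
  obtain ⟨b, hb, hb'⟩ := Finset.exists_ne_zero_of_sum_ne_zero h5.1
  have h6 : a + t + b ∈ A + B := by
    by_contra hcon
    exact hb' (if_neg hcon)
  refine Finset.mem_sub.2 ⟨a + t + b - a, Finset.sub_mem_sub h6 haA, b, hb, by abel⟩

end SetAddition

namespace SetAddition

universe u

variable {G : Type*} [AddCommGroup G] [DecidableEq G]

theorem card_add_nsmul_sub_le {A : Finset G} (hA : A.Nonempty) {L : ℝ}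
    (h : ((A + A).card : ℝ) ≤ Real.exp L * A.card) (N : ℕ) :
    ((A + N • (A - A)).card : ℝ) ≤ Real.exp ((2 * N + 1) * L) * A.card := by
  have hA0 : (0 : ℝ) < A.card := by exact_mod_cast hA.card_pos
  have h1 := Finset.pluennecke_ruzsa_inequality_nsmul_sub_nsmul_add hA A (N + 1) N
  have h2 := (NNRat.cast_le (K := ℝ)).2 h1
  push_cast at h2
  have heq : A + N • (A - A) = (N + 1) • A - N • A := by
    rw [nsmul_sub, succ_nsmul', add_sub_assoc]
  rw [heq]
  refine h2.trans (mul_le_mul_of_nonneg_right ?_ hA0.le)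
  have h3 : ((A + A).card : ℝ) / A.card ≤ Real.exp L := (div_le_iff₀ hA0).2 h
  refine (pow_le_pow_left₀ (by positivity) h3 _).trans_eq ?_
  rw [← Real.exp_nat_mul]
  push_cast
  congr 1
  ring

theorem card_nsmul_sub_le {A : Finset G} (hA : A.Nonempty) {L : ℝ}
    (h : ((A + A).card : ℝ) ≤ Real.exp L * A.card) (N : ℕ) :
    ((N • (A - A)).card : ℝ) ≤ Real.exp ((2 * N + 1) * L) * A.card := by
  refine le_trans ?_ (card_add_nsmul_sub_le hA h N)
  exact_mod_cast Finset.card_le_card_add_left hA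

theorem exists_lt_le_exp_div_mul (b : ℕ → ℝ) {k : ℕ} (hk : 1 ≤ k) {E : ℝ}
    (h : b k ≤ Real.exp E * b 0) : ∃ j < k, b (j + 1) ≤ Real.exp (E / k) * b j := by
  by_contra! hcon
  have key : ∀ j ≤ k, Real.exp (j * (E / k)) * b 0 ≤ b j ∧
      (1 ≤ j → Real.exp (j * (E / k)) * b 0 < b j) := by
    intro j
    induction j with
    | zero => simp
    | succ j ih =>
      intro hj
      have h1 := (ih (by omega)).1
      have h2 := hcon j (by omega)
      have h3 : Real.exp ((j + 1 : ℕ) * (E / k)) * b 0 < b (j + 1) := by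
        refine lt_of_le_of_lt ?_ h2
        push_cast
        rw [add_one_mul, Real.exp_add, mul_comm (Real.exp (j * (E / k))), mul_assoc]
        exact mul_le_mul_of_nonneg_left h1 (Real.exp_pos _).le
      exact ⟨h3.le, fun _ => h3⟩
  have h1 := (key k le_rfl).2 hk
  rw [mul_div_cancel₀ E (by positivity : (k : ℝ) ≠ 0)] at h1
  linarith

/-- One step of Konyagin's iteration. -/
theorem exists_symmNhd_nsmul_subset_step {A T : Finset G} (hA : A.Nonempty) {L : ℝ}
    (h : ((A + A).card : ℝ) ≤ Real.exp L * A.card) (hT : IsSymmNhd T) {k N : ℕ} (hk : 1 ≤ k)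
    (hkT : k • T ⊆ N • (A - A)) {k' l : ℕ} (hk' : 1 ≤ k') (hl : 1 ≤ l)
    (hlk : 8 * k' * Real.exp ((4 * N + 3) * L) < Real.exp ((l : ℝ) / (64 * k' ^ 2))) :
    ∃ T' : Finset G, IsSymmNhd T' ∧ k' • T' ⊆ (2 * N + 2) • (A - A) ∧
      (T.card : ℝ) ≤ 2 * Real.exp ((2 * N + 1) * L * l / k) * T'.card := by
  obtain ⟨hs, h0⟩ := hT
  have hA0 : (0 : ℝ) < A.card := by exact_mod_cast hA.card_pos
  have hAA : (0 : G) ∈ A - A := by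
    obtain ⟨a, ha⟩ := hA
    exact Finset.mem_sub.2 ⟨a, ha, a, ha, sub_self a⟩
  obtain ⟨j, hjk, hj⟩ := exists_lt_le_exp_div_mul (fun j => ((A + j • T).card : ℝ))
    hk
    (E := (2 * N + 1) * L) (by
      simp only [zero_nsmul, add_zero]
      refine le_trans ?_ (card_add_nsmul_sub_le hA h N)
      exact_mod_cast Finset.card_le_card (Finset.add_subset_add_left hkT))
  set B := A + j • T with hBdef
  have hB : B.Nonempty := hA.add ⟨0, zero_mem_nsmul h0 j⟩
  have hB0 : (0 : ℝ) < B.card := by exact_mod_cast hB.card_pos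
  have hBT : A + (j + 1) • T = B + T := by rw [succ_nsmul, ← add_assoc]
  simp only [hBT] at hj
  have hjT : j • T ⊆ N • (A - A) := (nsmul_subset_nsmul_of_le h0 hjk.le).trans hkT
  have hBB : B - B ⊆ (2 * N + 1) • (A - A) := by
    rw [hBdef, add_sub_add_comm, sub_eq_add_neg (j • T), neg_nsmul_eq hs, succ_nsmul', two_mul,
      add_nsmul]
    exact Finset.add_subset_add_left (Finset.add_subset_add hjT hjT)
  have hQ : ((A + B - B).card : ℝ) ≤ Real.exp ((4 * N + 3) * L) * A.card := by
    rw [add_sub_assoc]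
    refine le_trans (b := ((A + (2 * N + 1) • (A - A)).card : ℝ)) ?_ ?_
    · exact_mod_cast Finset.card_le_card (Finset.add_subset_add_left hBB)
    · refine (card_add_nsmul_sub_le hA h (2 * N + 1)).trans_eq ?_
      push_cast
      ring_nf
  obtain ⟨T₀, hT₀, hcard, hsub⟩ := exists_nsmul_sub_subset (S := T) hA hB hk' hl (by
    rw [Real.exp_neg, ← div_eq_mul_inv, div_mul_eq_mul_div, div_lt_iff₀ (Real.exp_pos _)]
    have hk0 : (0 : ℝ) < k' := by exact_mod_cast hk'
    calc 8 * (k' : ℝ) * (A + B - B).card ≤ 8 * k' * (Real.exp ((4 * N + 3) * L) * A.card) :=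
          mul_le_mul_of_nonneg_left hQ (by positivity)
      _ = (8 * k' * Real.exp ((4 * N + 3) * L)) * A.card := by ring
      _ < _ := by
          rw [mul_comm (A.card : ℝ)]
          exact mul_lt_mul_of_pos_right hlk hA0)
  have hTpos : (0 : ℝ) < T.card := by exact_mod_cast Finset.card_pos.2 ⟨0, h0⟩
  have hT₀ne : T₀.Nonempty := by
    rw [Finset.nonempty_iff_ne_empty]
    rintro rfl
    simp only [Finset.card_empty, Nat.cast_zero, mul_zero] at hcard
    have : 0 < (T.card : ℝ) * (B.card : ℝ) ^ l := by positivity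
    linarith
  refine ⟨T₀ - T₀, ⟨neg_sub_self T₀, ?_⟩, ?_, ?_⟩
  · obtain ⟨a, ha⟩ := hT₀ne
    exact Finset.mem_sub.2 ⟨a, ha, a, ha, sub_self a⟩
  · refine hsub.trans ?_
    rw [sub_sub, add_sub_add_comm, show 2 * N + 2 = (2 * N + 1) + 1 by rfl,
      succ_nsmul']
    exact Finset.add_subset_add_left hBB
  · have h1 : (T₀.card : ℝ) ≤ (T₀ - T₀).card := by
      rw [sub_eq_add_neg]
      exact_mod_cast Finset.card_le_card_add_right hT₀ne.neg
    have h2 : ((B + T).card : ℝ) ^ l ≤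
        Real.exp ((2 * N + 1) * L * l / k) * (B.card : ℝ) ^ l := by
      refine (pow_le_pow_left₀ (by positivity) hj l).trans_eq ?_
      rw [mul_pow, ← Real.exp_nat_mul]
      congr 2
      ring
    have h3 : (T.card : ℝ) * (B.card : ℝ) ^ l ≤
        2 * Real.exp ((2 * N + 1) * L * l / k) * (T₀ - T₀).card * (B.card : ℝ) ^ l := by
      calc _ ≤ 2 * ((B + T).card : ℝ) ^ l * T₀.card := hcard
        _ ≤ 2 * (Real.exp ((2 * N + 1) * L * l / k) * (B.card : ℝ) ^ l) * (T₀ - T₀).card := by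
            gcongr
        _ = _ := by ring
    exact le_of_mul_le_mul_right h3 (by positivity)

/-- Every set `A` of doubling at most `exp L` admits a symmetric neighbourhood `T` of size at least
`exp (-C * L ^ (3 + η)) * |A|` with `kT ⊆ N(A - A)` for some `k ≥ c * L ^ a`. -/
def HasLargeRoots (η a : ℝ) (N : ℕ) (c C : ℝ) : Prop :=
  ∀ (G : Type u) [AddCommGroup G] [DecidableEq G] (A : Finset G) (L : ℝ), 1 ≤ L → A.Nonempty →
    ((A + A).card : ℝ) ≤ Real.exp L * A.card →
    ∃ (T : Finset G) (k : ℕ), IsSymmNhd T ∧ c * L ^ a ≤ k ∧ k • T ⊆ N • (A - A) ∧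
      (A.card : ℝ) ≤ Real.exp (C * L ^ (3 + η)) * T.card

theorem hasLargeRoots_zero (η : ℝ) : HasLargeRoots.{u} η 0 1 1 0 := by
  intro G _ _ A L hL hA h
  refine ⟨A - A, 1, ⟨neg_sub_self A, ?_⟩, by simp, subset_rfl, ?_⟩
  · obtain ⟨a, ha⟩ := hA
    exact Finset.mem_sub.2 ⟨a, ha, a, ha, sub_self a⟩
  · rw [zero_mul, Real.exp_zero, one_mul, sub_eq_add_neg]
    exact_mod_cast Finset.card_le_card_add_right hA.neg

theorem HasLargeRoots.step {η a C c : ℝ} {N : ℕ} (h : HasLargeRoots.{u} η a N 1 C)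
    (ha : 0 ≤ a) (ha2 : a ≤ 2) (hη : 0 ≤ η) (hη2 : η ≤ 1) (hc : 1 ≤ c) :
    ∃ C', HasLargeRoots.{u} η ((a + 1 + η) / 2) (2 * N + 2) c C' := by
  set a' := (a + 1 + η) / 2 with ha'
  refine ⟨C + (1 + (2 * N + 1) * (256 * c ^ 2 * (16 * c + 4 * N + 5) + 2)), ?_⟩
  intro G _ _ A L hL hA hAA
  obtain ⟨T, k, hT, hk, hkT, hcard⟩ := h G A L hL hA hAA
  rw [one_mul] at hk
  have hL0 : 0 < L := by linarith
  have hLa : 1 ≤ L ^ a := Real.one_le_rpow hL ha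
  have hk1 : 1 ≤ k := by exact_mod_cast hLa.trans hk
  have ha'0 : 0 ≤ a' := by rw [ha']; linarith
  have hLa' : 1 ≤ L ^ a' := Real.one_le_rpow hL ha'0
  have hx : 1 ≤ c * L ^ a' := by nlinarith
  set k' := ⌈c * L ^ a'⌉₊ with hk'
  have hk'1 : c * L ^ a' ≤ k' := Nat.le_ceil _
  have hk'2 : (k' : ℝ) ≤ 2 * (c * L ^ a') := by
    have := Nat.ceil_lt_add_one (zero_le_one.trans hx)
    linarith
  have hk'pos : (1 : ℝ) ≤ k' := hx.trans hk'1
  set x := 64 * (k' : ℝ) ^ 2 * ((16 * c + 2) * L + (4 * N + 3) * L) with hxdef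
  have hx0 : 0 ≤ x := by positivity
  set l := ⌈x⌉₊ + 1 with hl
  have hlx : x < l := by
    have := Nat.le_ceil x
    rw [hl]; push_cast; linarith
  have hlx2 : (l : ℝ) ≤ x + 2 := by
    have := Nat.ceil_lt_add_one hx0
    rw [hl]; push_cast; linarith
  have hlog : 8 * (k' : ℝ) ≤ Real.exp ((16 * c + 2) * L) := by
    have h1 : L ^ a' ≤ L ^ (2 : ℝ) :=
      Real.rpow_le_rpow_of_exponent_le hL (by rw [ha']; linarith)
    have h2 : L ^ (2 : ℝ) ≤ Real.exp (2 * L) := by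
      rw [Real.rpow_two, show 2 * L = ((2 : ℕ) : ℝ) * L by norm_num, Real.exp_nat_mul]
      exact pow_le_pow_left₀ hL0.le (by linarith [Real.add_one_le_exp L]) 2
    have h3 : 16 * c ≤ Real.exp (16 * c * L) := by
      have := Real.add_one_le_exp (16 * c * L)
      nlinarith
    calc 8 * (k' : ℝ) ≤ 16 * c * L ^ a' := by linarith
      _ ≤ Real.exp (16 * c * L) * Real.exp (2 * L) := by
          exact mul_le_mul h3 (h1.trans h2) (by positivity) (Real.exp_pos _).le
      _ = _ := by rw [← Real.exp_add]; ring_nf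
  obtain ⟨T', hT', hsub, hcard'⟩ := exists_symmNhd_nsmul_subset_step hA hAA hT hk1 hkT
    (k' := k') (l := l) (by exact_mod_cast hk'pos) (by omega) (by
      have h1 : (16 * c + 2) * L + (4 * N + 3) * L < (l : ℝ) / (64 * k' ^ 2) := by
        rw [lt_div_iff₀ (by positivity)]
        linarith
      refine lt_of_le_of_lt ?_ (Real.exp_lt_exp.2 h1)
      rw [Real.exp_add]
      exact mul_le_mul_of_nonneg_right hlog (Real.exp_pos _).le)
  refine ⟨T', k', hT', hk'1, hsub, ?_⟩
  set Y := L ^ (3 + η) with hY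
  have hY1 : 1 ≤ Y := Real.one_le_rpow hL (by linarith)
  have hlY : (2 * N + 1) * L * l / k ≤ (2 * N + 1) * (256 * c ^ 2 * (16 * c + 4 * N + 5) + 2) * Y := by
    have hkk : (k' : ℝ) ^ 2 ≤ 4 * c ^ 2 * L ^ (2 * a') := by
      have h1 := pow_le_pow_left₀ (by positivity) hk'2 2
      refine h1.trans_eq ?_
      rw [mul_pow, mul_pow, ← Real.rpow_mul_natCast hL0.le]
      push_cast
      rw [mul_comm a' 2]
      ring
    have hl3 : (l : ℝ) ≤ (256 * c ^ 2 * (16 * c + 4 * N + 5) + 2) * (L ^ (2 * a') * L) := by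
      have h2a : 1 ≤ L ^ (2 * a') := Real.one_le_rpow hL (by linarith)
      have h2 : x ≤ 64 * (4 * c ^ 2 * L ^ (2 * a')) * ((16 * c + 2) * L + (4 * N + 3) * L) := by
        rw [hxdef]; gcongr
      have h3 : 1 ≤ L ^ (2 * a') * L := by nlinarith
      nlinarith
    have hkpos : (0 : ℝ) < k := by exact_mod_cast hk1
    rw [div_le_iff₀ hkpos]
    have hpow : L * (L ^ (2 * a') * L) = Y * L ^ a := by
      rw [hY, ← Real.rpow_add hL0]
      nth_rewrite 1 [← Real.rpow_one L]
      nth_rewrite 3 [← Real.rpow_one L]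
      rw [← Real.rpow_add hL0, ← Real.rpow_add hL0]
      congr 1
      rw [ha']; ring
    calc (2 * N + 1) * L * (l : ℝ)
        ≤ (2 * N + 1) * L * ((256 * c ^ 2 * (16 * c + 4 * N + 5) + 2) * (L ^ (2 * a') * L)) := by
          gcongr
      _ = (2 * N + 1) * (256 * c ^ 2 * (16 * c + 4 * N + 5) + 2) * (L * (L ^ (2 * a') * L)) := by
          ring
      _ = (2 * N + 1) * (256 * c ^ 2 * (16 * c + 4 * N + 5) + 2) * Y * L ^ a := by
          rw [hpow]; ring
      _ ≤ _ := by gcongr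
  have h2 : (2 : ℝ) ≤ Real.exp Y := by linarith [Real.add_one_le_exp Y]
  calc (A.card : ℝ) ≤ Real.exp (C * Y) * T.card := hcard
    _ ≤ Real.exp (C * Y) * (2 * Real.exp ((2 * N + 1) * L * l / k) * T'.card) := by gcongr
    _ ≤ Real.exp (C * Y) * (Real.exp Y *
          Real.exp ((2 * N + 1) * (256 * c ^ 2 * (16 * c + 4 * N + 5) + 2) * Y) * T'.card) := by
        gcongr
    _ = _ := by
        rw [← mul_assoc, ← Real.exp_add, ← Real.exp_add]
        ring_nf

theorem exists_hasLargeRoots {η : ℝ} (hη : 0 < η) (hη2 : η ≤ 1) :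
    ∃ N : ℕ, ∀ c, 1 ≤ c → ∃ C, HasLargeRoots.{u} η 1 N c C := by
  have key : ∀ i : ℕ, ∃ (N : ℕ) (C : ℝ),
      HasLargeRoots.{u} η ((1 + η) * (1 - (1 / 2) ^ i)) N 1 C := by
    intro i
    induction i with
    | zero => exact ⟨1, 0, by simpa using hasLargeRoots_zero η⟩
    | succ i ih =>
      obtain ⟨N, C, h⟩ := ih
      have h1 : ((1 : ℝ) / 2) ^ i ≤ 1 := pow_le_one₀ (by norm_num) (by norm_num)
      have h2 : (0 : ℝ) < (1 / 2) ^ i := by positivity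
      obtain ⟨C', h'⟩ := h.step (mul_nonneg (by linarith) (by linarith)) (by nlinarith) hη.le hη2
        le_rfl
      refine ⟨2 * N + 2, C', ?_⟩
      convert h' using 1
      rw [pow_succ]
      ring
  obtain ⟨i, hi⟩ := exists_pow_lt_of_lt_one (show 0 < η / 2 by linarith)
    (show (1 : ℝ) / 2 < 1 by norm_num)
  obtain ⟨N, C, h⟩ := key i
  have h2 : (0 : ℝ) < (1 / 2) ^ i := by positivity
  have h1 : ((1 : ℝ) / 2) ^ i ≤ 1 := pow_le_one₀ (by norm_num) (by norm_num)
  refine ⟨2 * N + 2, fun c hc => ?_⟩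
  obtain ⟨C', h'⟩ := h.step (mul_nonneg (by linarith) (by linarith)) (by nlinarith) hη.le hη2 hc
  refine ⟨C', fun G _ _ A L hL hA hAA => ?_⟩
  obtain ⟨T, k, hT, hk, hrest⟩ := h' G A L hL hA hAA
  refine ⟨T, k, hT, le_trans ?_ hk, hrest⟩
  refine mul_le_mul_of_nonneg_left ?_ (by linarith)
  exact Real.rpow_le_rpow_of_exponent_le hL (by nlinarith)

end SetAddition

namespace SetAddition

section FiniteFourier

variable {H : Type*} [AddCommGroup H] [Fintype H] [DecidableEq H]

/-- The Fourier transform of the uniform probability measure on `P`. -/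
noncomputable def ft (P : Finset H) (γ : AddChar H ℂ) : ℂ :=
  (∑ x ∈ P, γ x) / P.card

/-- `F` is the Fourier transform of a function of total mass `1` supported on `Z`. -/
def Realizes (F : AddChar H ℂ → ℂ) (Z : Finset H) : Prop :=
  ∃ f : H → ℂ, ∑ x, f x = 1 ∧ (∀ x ∉ Z, f x = 0) ∧ ∀ γ, F γ = ∑ x, f x * γ x

theorem realizes_ft {P : Finset H} (hP : P.Nonempty) : Realizes (ft P) P := by
  have h0 : (P.card : ℂ) ≠ 0 := by exact_mod_cast hP.card_ne_zero
  refine ⟨fun x => if x ∈ P then 1 / (P.card : ℂ) else 0, ?_, fun x hx => if_neg hx, fun γ => ?_⟩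
  · rw [← Finset.sum_filter, Finset.filter_mem_eq_inter, Finset.univ_inter, Finset.sum_const,
      nsmul_eq_mul]
    field_simp
  · simp only [ite_mul, zero_mul]
    rw [← Finset.sum_filter, Finset.filter_mem_eq_inter, Finset.univ_inter, ft, Finset.sum_div]
    exact Finset.sum_congr rfl fun x _ => by ring

theorem Realizes.mul {F F' : AddChar H ℂ → ℂ} {Z Z' : Finset H} (h : Realizes F Z)
    (h' : Realizes F' Z') : Realizes (fun γ => F γ * F' γ) (Z + Z') := by
  obtain ⟨f, hf1, hfZ, hf⟩ := h
  obtain ⟨f', hf1', hfZ', hf'⟩ := h'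
  have hshift : ∀ (g : H → ℂ) (y : H), ∑ x, g (x - y) = ∑ x, g x := fun g y =>
    Equiv.sum_comp (Equiv.subRight y) g
  refine ⟨fun x => ∑ y, f y * f' (x - y), ?_, fun x hx => ?_, fun γ => ?_⟩
  · rw [Finset.sum_comm]
    simp_rw [← Finset.mul_sum, hshift f', hf1', mul_one, hf1]
  · refine Finset.sum_eq_zero fun y _ => ?_
    by_cases hy : y ∈ Z
    · rw [hfZ' (x - y), mul_zero]
      exact fun hxy => hx (Finset.mem_add.2 ⟨y, hy, x - y, hxy, by abel⟩)
    · rw [hfZ y hy, zero_mul]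
  · simp_rw [Finset.sum_mul]
    rw [Finset.sum_comm, hf, hf', Finset.sum_mul]
    refine Finset.sum_congr rfl fun y _ => ?_
    rw [← hshift (fun x => f' x * γ x) y, Finset.mul_sum]
    refine Finset.sum_congr rfl fun x _ => ?_
    have : γ x = γ y * γ (x - y) := by rw [← AddChar.map_add_eq_mul]; congr 1; abel
    rw [this]
    ring

theorem realizes_one : Realizes (fun _ : AddChar H ℂ => 1) ({0} : Finset H) :=
  ⟨fun x => if x = 0 then 1 else 0, by simp, by simp, by simp⟩

theorem Realizes.pow {F : AddChar H ℂ → ℂ} {Z : Finset H} (h : Realizes F Z) (n : ℕ) :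
    Realizes (fun γ => F γ ^ n) (n • Z) := by
  induction n with
  | zero => simpa [Finset.singleton_zero] using realizes_one (H := H)
  | succ n ih =>
    simp_rw [pow_succ]
    rw [succ_nsmul]
    exact ih.mul h

theorem sum_addChar_mul_conj (x y : H) :
    ∑ γ : AddChar H ℂ, γ x * (starRingEnd ℂ) (γ y) = if x = y then (Fintype.card H : ℂ) else 0 := by
  simp_rw [← AddChar.map_neg_eq_conj, ← AddChar.map_add_eq_mul]
  rw [AddChar.sum_apply_eq_ite]
  simp [← sub_eq_add_neg, sub_eq_zero]

theorem sum_fourier_mul_conj (f : H → ℂ) (x : H) :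
    ∑ γ : AddChar H ℂ, (∑ y, f y * γ y) * (starRingEnd ℂ) (γ x) = Fintype.card H * f x := by
  simp_rw [Finset.sum_mul]
  rw [Finset.sum_comm]
  simp_rw [mul_assoc, ← Finset.mul_sum, sum_addChar_mul_conj]
  simp [mul_comm]

theorem sum_norm_sq_fourier (f : H → ℂ) :
    ∑ γ : AddChar H ℂ, ‖∑ y, f y * γ y‖ ^ 2 = Fintype.card H * ∑ x, ‖f x‖ ^ 2 := by
  have h : (∑ γ : AddChar H ℂ, ((‖∑ y, f y * γ y‖ : ℂ)) ^ 2) =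
      Fintype.card H * ∑ x, ((‖f x‖ : ℂ)) ^ 2 := by
    simp_rw [← Complex.mul_conj']
    calc ∑ γ : AddChar H ℂ, (∑ y, f y * γ y) * (starRingEnd ℂ) (∑ y, f y * γ y)
        = ∑ γ : AddChar H ℂ, ∑ x, (starRingEnd ℂ) (f x) *
            ((∑ y, f y * γ y) * (starRingEnd ℂ) (γ x)) := by
          refine Finset.sum_congr rfl fun γ _ => ?_
          rw [map_sum, Finset.mul_sum]
          refine Finset.sum_congr rfl fun x _ => ?_
          rw [map_mul]
          ring
      _ = _ := by
          rw [Finset.sum_comm]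
          simp_rw [← Finset.mul_sum, sum_fourier_mul_conj]
          rw [Finset.mul_sum]
          exact Finset.sum_congr rfl fun x _ => by ring
  exact_mod_cast h

theorem Realizes.mem_of_sum_ne_zero {F : AddChar H ℂ → ℂ} {Z : Finset H} (h : Realizes F Z) {x : H}
    (hx : ∑ γ, F γ * (starRingEnd ℂ) (γ x) ≠ 0) : x ∈ Z := by
  obtain ⟨f, -, hfZ, hf⟩ := h
  by_contra hxZ
  simp_rw [hf] at hx
  rw [sum_fourier_mul_conj, hfZ x hxZ, mul_zero] at hx
  exact hx rfl

theorem Realizes.card_le {F : AddChar H ℂ → ℂ} {Z : Finset H} (h : Realizes F Z) :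
    (Fintype.card H : ℝ) ≤ Z.card * ∑ γ, ‖F γ‖ ^ 2 := by
  obtain ⟨f, hf1, hfZ, hf⟩ := h
  simp_rw [hf]
  rw [sum_norm_sq_fourier]
  have h1 : (1 : ℝ) ≤ (∑ x ∈ Z, ‖f x‖) ^ 2 := by
    have h2 : ∑ x ∈ Z, f x = 1 := by
      rw [← hf1]
      exact Finset.sum_subset (Finset.subset_univ Z) fun x _ hx => hfZ x hx
    have h3 := norm_sum_le Z f
    rw [h2, norm_one] at h3
    nlinarith
  have h2 : (∑ x ∈ Z, ‖f x‖) ^ 2 ≤ Z.card * ∑ x, ‖f x‖ ^ 2 :=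
    sq_sum_le_card_mul_sum_sq.trans (mul_le_mul_of_nonneg_left
      (Finset.sum_le_sum_of_subset_of_nonneg (Finset.subset_univ Z) fun x _ _ => by positivity)
      (Nat.cast_nonneg _))
  have h3 := h1.trans h2
  nlinarith [Nat.cast_nonneg (α := ℝ) (Fintype.card H)]

theorem sum_norm_sq_ft {P : Finset H} (hP : P.Nonempty) :
    ∑ γ : AddChar H ℂ, ‖ft P γ‖ ^ 2 = Fintype.card H / P.card := by
  have h0 : (P.card : ℝ) ≠ 0 := by exact_mod_cast hP.card_ne_zero
  have h := sum_norm_sq_fourier (fun x => if x ∈ P then (1 / P.card : ℂ) else 0)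
  have h1 : ∀ γ : AddChar H ℂ,
      ∑ y, (if y ∈ P then (1 / P.card : ℂ) else 0) * γ y = ft P γ := by
    intro γ
    simp only [ite_mul, zero_mul]
    rw [← Finset.sum_filter, Finset.filter_mem_eq_inter, Finset.univ_inter, ft, Finset.sum_div]
    exact Finset.sum_congr rfl fun x _ => by ring
  simp_rw [h1] at h
  rw [h]
  have h2 : ∀ x, ‖(if x ∈ P then (1 / P.card : ℂ) else 0)‖ ^ 2 =
      if x ∈ P then 1 / (P.card : ℝ) ^ 2 else 0 := by
    intro x
    split_ifs <;> simp
  simp_rw [h2]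
  rw [← Finset.sum_filter, Finset.filter_mem_eq_inter, Finset.univ_inter, Finset.sum_const,
    nsmul_eq_mul]
  field_simp

theorem norm_ft_le_one (P : Finset H) (γ : AddChar H ℂ) : ‖ft P γ‖ ≤ 1 := by
  rw [ft, norm_div, Complex.norm_natCast]
  refine div_le_one_of_le₀ ?_ (Nat.cast_nonneg _)
  refine (norm_sum_le _ _).trans ?_
  simp [AddChar.norm_apply]

theorem ft_neg_set (P : Finset H) (γ : AddChar H ℂ) : ft (-P) γ = (starRingEnd ℂ) (ft P γ) := by
  rw [ft, ft, map_div₀, map_sum, Finset.card_neg, map_natCast, Finset.sum_neg_index]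
  simp_rw [AddChar.map_neg_eq_conj]

theorem realizes_norm_sq_ft {P : Finset H} (hP : P.Nonempty) :
    Realizes (fun γ => ((‖ft P γ‖ ^ 2 : ℝ) : ℂ)) (P - P) := by
  have := (realizes_ft hP).mul (realizes_ft hP.neg)
  rw [← sub_eq_add_neg] at this
  convert this using 2 with γ
  rw [ft_neg_set, Complex.mul_conj']
  push_cast
  rfl

theorem norm_sq_ft_eq_sum_re (P : Finset H) (γ : AddChar H ℂ) :
    ‖ft P γ‖ ^ 2 = (∑ a ∈ P, ∑ b ∈ P, (γ (a - b)).re) / (P.card : ℝ) ^ 2 := by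
  have h : ((‖ft P γ‖ : ℂ)) ^ 2 = (∑ a ∈ P, ∑ b ∈ P, γ (a - b)) / (P.card : ℂ) ^ 2 := by
    rw [← Complex.mul_conj', ft, map_div₀, map_sum, map_natCast, div_mul_div_comm,
      Finset.sum_mul_sum, sq]
    simp_rw [sub_eq_add_neg, AddChar.map_add_eq_mul, AddChar.map_neg_eq_conj]
  have h2 := congrArg Complex.re h
  have h3 : ((∑ a ∈ P, ∑ b ∈ P, γ (a - b)) / (P.card : ℂ) ^ 2).re =
      (∑ a ∈ P, ∑ b ∈ P, (γ (a - b)).re) / (P.card : ℝ) ^ 2 := by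
    rw [show ((P.card : ℂ)) ^ 2 = (((P.card : ℝ) ^ 2 : ℝ) : ℂ) by push_cast; rfl,
      Complex.div_ofReal_re, Complex.re_sum]
    simp_rw [Complex.re_sum]
  rw [← h3, ← h2]
  norm_cast

theorem one_sub_re_mul_le {z w : ℂ} (hz : ‖z‖ = 1) (hw : ‖w‖ = 1) :
    1 - (z * w).re ≤ 2 * (1 - z.re) + 2 * (1 - w.re) := by
  have h1 : z.re ^ 2 + z.im ^ 2 = 1 := by
    have := Complex.sq_norm z
    rw [hz, Complex.normSq_apply] at this; linarith
  have h2 : w.re ^ 2 + w.im ^ 2 = 1 := by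
    have := Complex.sq_norm w
    rw [hw, Complex.normSq_apply] at this; linarith
  rw [Complex.mul_re]
  nlinarith [sq_nonneg (1 - z.re - (1 - w.re)), sq_nonneg (z.im - w.im),
    sq_nonneg (z.im + w.im), sq_nonneg (z.re + w.re - 2)]

/-- The set of characters at which the Fourier transform of the uniform measure on `T` has squared
modulus at least `1 - θ`. -/
noncomputable def largeSpec (T : Finset H) (θ : ℝ) : Finset (AddChar H ℂ) := by
  classical exact Finset.univ.filter fun γ => 1 - θ ≤ ‖ft T γ‖ ^ 2

theorem mem_largeSpec {T : Finset H} {θ : ℝ} {γ : AddChar H ℂ} :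
    γ ∈ largeSpec T θ ↔ 1 - θ ≤ ‖ft T γ‖ ^ 2 := by
  simp [largeSpec]

theorem largeSpec_mono (T : Finset H) {θ θ' : ℝ} (h : θ ≤ θ') :
    largeSpec T θ ⊆ largeSpec T θ' := fun γ hγ => by
  rw [mem_largeSpec] at hγ ⊢
  linarith

theorem zero_mem_largeSpec {T : Finset H} (hT : T.Nonempty) {θ : ℝ} (hθ : 0 ≤ θ) :
    0 ∈ largeSpec T θ := by
  have h0 : (T.card : ℂ) ≠ 0 := by exact_mod_cast hT.card_ne_zero
  rw [mem_largeSpec, ft]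
  simp only [AddChar.zero_apply, Finset.sum_const, nsmul_eq_mul, mul_one]
  rw [div_self h0]
  simpa using hθ

theorem neg_mem_largeSpec {T : Finset H} {θ : ℝ} {γ : AddChar H ℂ} (h : γ ∈ largeSpec T θ) :
    -γ ∈ largeSpec T θ := by
  rw [mem_largeSpec] at h ⊢
  have : ft T (-γ) = (starRingEnd ℂ) (ft T γ) := by
    rw [ft, ft, map_div₀, map_sum, map_natCast]
    simp_rw [AddChar.neg_apply, AddChar.map_neg_eq_conj]
  rwa [this, RCLike.norm_conj]

theorem add_mem_largeSpec {T : Finset H} (hT : T.Nonempty) {θ : ℝ} {γ γ' : AddChar H ℂ}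
    (h : γ ∈ largeSpec T θ) (h' : γ' ∈ largeSpec T θ) : γ + γ' ∈ largeSpec T (4 * θ) := by
  rw [mem_largeSpec] at h h' ⊢
  have h0 : (0 : ℝ) < (T.card : ℝ) ^ 2 := by
    have : (0 : ℝ) < T.card := by exact_mod_cast hT.card_pos
    positivity
  rw [norm_sq_ft_eq_sum_re, le_div_iff₀ h0] at h h' ⊢
  have h1 : ∀ a ∈ T, ∀ b ∈ T, 2 * (γ (a - b)).re + 2 * (γ' (a - b)).re - 3 ≤
      ((γ + γ') (a - b)).re := by
    intro a _ b _
    rw [AddChar.add_apply]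
    linarith [one_sub_re_mul_le (AddChar.norm_apply γ (a - b)) (AddChar.norm_apply γ' (a - b))]
  have h2 := Finset.sum_le_sum fun a ha => Finset.sum_le_sum fun b hb => h1 a ha b hb
  simp only [Finset.sum_sub_distrib, Finset.sum_add_distrib, ← Finset.mul_sum, Finset.sum_const,
    nsmul_eq_mul] at h2
  nlinarith

theorem add_largeSpec_subset [DecidableEq (AddChar H ℂ)] {T : Finset H} (hT : T.Nonempty)
    (θ : ℝ) : largeSpec T θ + largeSpec T θ ⊆ largeSpec T (4 * θ) := by
  intro χ hχ
  obtain ⟨γ, hγ, γ', hγ', rfl⟩ := Finset.mem_add.1 hχ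
  exact add_mem_largeSpec hT hγ hγ'

theorem sub_largeSpec_subset [DecidableEq (AddChar H ℂ)] {T : Finset H} (hT : T.Nonempty)
    (θ : ℝ) : largeSpec T θ - largeSpec T θ ⊆ largeSpec T (4 * θ) := by
  intro χ hχ
  obtain ⟨γ, hγ, γ', hγ', rfl⟩ := Finset.mem_sub.1 hχ
  rw [sub_eq_add_neg]
  exact add_mem_largeSpec hT hγ (neg_mem_largeSpec hγ')

theorem card_largeSpec_le {T : Finset H} (hT : T.Nonempty) {θ : ℝ} (hθ : θ ≤ 1 / 2) :
    ((largeSpec T θ).card : ℝ) ≤ 2 * (Fintype.card H / T.card) := by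
  rw [← sum_norm_sq_ft hT, Finset.mul_sum]
  calc ((largeSpec T θ).card : ℝ) = ∑ γ ∈ largeSpec T θ, (1 : ℝ) := by simp
    _ ≤ ∑ γ ∈ largeSpec T θ, 2 * ‖ft T γ‖ ^ 2 := by
        refine Finset.sum_le_sum fun γ hγ => ?_
        rw [mem_largeSpec] at hγ
        linarith
    _ ≤ _ := Finset.sum_le_sum_of_subset_of_nonneg (Finset.subset_univ _)
        fun γ _ _ => by positivity

/-- The average of the characters in `P` at the point `x`. -/
noncomputable def dualAvg (P : Finset (AddChar H ℂ)) (x : H) : ℂ :=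
  (∑ γ ∈ P, γ x) / P.card

theorem dualAvg_eq_ft (P : Finset (AddChar H ℂ)) (x : H) :
    dualAvg P x = ft P (AddChar.doubleDualEquiv x) := by
  rw [dualAvg, ft]
  rfl

theorem sum_comp_doubleDual (g : AddChar (AddChar H ℂ) ℂ → ℝ) :
    ∑ x : H, g (AddChar.doubleDualEquiv x) = ∑ Ψ, g Ψ :=
  Equiv.sum_comp AddChar.doubleDualEquiv.toEquiv g

theorem sum_norm_sq_dualAvg {P : Finset (AddChar H ℂ)} (hP : P.Nonempty) :
    ∑ x, ‖dualAvg P x‖ ^ 2 = Fintype.card H / P.card := by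
  classical
  simp_rw [dualAvg_eq_ft]
  rw [sum_comp_doubleDual (fun Ψ => ‖ft P Ψ‖ ^ 2), sum_norm_sq_ft hP, AddChar.card_eq]

theorem card_le_card_nsmul_mul_sum [DecidableEq (AddChar H ℂ)] {P : Finset (AddChar H ℂ)}
    (hP : P.Nonempty) (q : ℕ) :
    (Fintype.card H : ℝ) ≤ (q • P).card * ∑ x, ‖dualAvg P x‖ ^ (2 * q) := by
  have h := ((realizes_ft hP).pow q).card_le
  rw [AddChar.card_eq] at h
  simp_rw [dualAvg_eq_ft]
  rw [sum_comp_doubleDual (fun Ψ => ‖ft P Ψ‖ ^ (2 * q))]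
  refine h.trans_eq ?_
  congr 1
  refine Finset.sum_congr rfl fun Ψ _ => ?_
  rw [norm_pow, ← pow_mul, mul_comm]

end FiniteFourier

end SetAddition

namespace SetAddition

section RelativeChang

variable {H : Type*} [AddCommGroup H] [Fintype H] [DecidableEq H]

/-- The Riesz product `∏ (1 + Re λ / 8)` over a list of characters. -/
noncomputable def riesz : List (AddChar H ℂ) → H → ℝ
  | [], _ => 1
  | γ :: l, x => (1 + (γ x).re / 8) * riesz l x

variable [DecidableEq (AddChar H ℂ)]

/-- No character in the list lies in the span of the later ones up to `Δ`. -/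
def IsDissociated (Δ : Finset (AddChar H ℂ)) : List (AddChar H ℂ) → Prop
  | [] => True
  | γ :: l => γ ∉ spanList l + Δ ∧ IsDissociated Δ l

theorem abs_re_le_one (γ : AddChar H ℂ) (x : H) : |(γ x).re| ≤ 1 :=
  (Complex.abs_re_le_norm _).trans_eq (AddChar.norm_apply γ x)

theorem exp_sub_le_one_add {u : ℝ} (h : -1 ≤ u) (h' : u ≤ 1) :
    Real.exp (u / 8 - 1 / 64) ≤ 1 + u / 8 := by
  rcases le_total 0 (u / 8 - 1 / 64) with hy | hy
  · have h3 := (abs_le.1 (Real.abs_exp_sub_one_sub_id_le (x := u / 8 - 1 / 64)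
      (by rw [abs_le]; constructor <;> linarith))).2
    nlinarith
  · have h3 := Real.quadratic_le_exp_of_nonneg (x := -(u / 8 - 1 / 64)) (by linarith)
    rw [Real.exp_neg] at h3
    have h4 := Real.exp_pos (u / 8 - 1 / 64)
    rw [le_inv_comm₀ (by nlinarith) h4] at h3
    refine h3.trans (inv_le_of_inv_le₀ (by linarith) ?_)
    rw [inv_le_iff_one_le_mul₀ (by linarith)]
    nlinarith [mul_nonneg (by linarith : 0 ≤ 1 + u) (by linarith : 0 ≤ 1 - u),
      mul_nonneg (mul_nonneg (by linarith : 0 ≤ 1 + u) (by linarith : 0 ≤ 1 - u))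
        (by linarith : 0 ≤ 1 + u)]

theorem exp_le_riesz (l : List (AddChar H ℂ)) (x : H) :
    Real.exp ((l.map fun γ => (γ x).re / 8 - 1 / 64).sum) ≤ riesz l x := by
  induction l with
  | nil => simp [riesz]
  | cons γ l ih =>
    rw [List.map_cons, List.sum_cons, Real.exp_add, riesz]
    have h1 := abs_le.1 (abs_re_le_one γ x)
    refine mul_le_mul ?_ ih (Real.exp_pos _).le (by linarith)
    exact exp_sub_le_one_add h1.1 h1.2

theorem norm_sq_dualAvg_eq (P : Finset (AddChar H ℂ)) (x : H) :
    ‖dualAvg P x‖ ^ 2 = (∑ γ ∈ P, ∑ γ' ∈ P, ((γ - γ') x).re) / (P.card : ℝ) ^ 2 := by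
  rw [dualAvg_eq_ft, norm_sq_ft_eq_sum_re]
  rfl

theorem norm_sq_dualAvg_eq_complex (P : Finset (AddChar H ℂ)) (x : H) :
    ((‖dualAvg P x‖ ^ 2 : ℝ) : ℂ) = (∑ γ ∈ P, ∑ γ' ∈ P, (γ - γ') x) / (P.card : ℂ) ^ 2 := by
  push_cast
  rw [← Complex.mul_conj', dualAvg, map_div₀, map_sum, map_natCast, div_mul_div_comm,
    Finset.sum_mul_sum, sq]
  simp_rw [sub_eq_add_neg, AddChar.add_apply, AddChar.neg_apply, AddChar.map_neg_eq_conj]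

theorem sum_dualAvg_mul_riesz_mul_eq_zero (P : Finset (AddChar H ℂ)) (l : List (AddChar H ℂ))
    {χ : AddChar H ℂ} (hχ : χ ∉ spanList l + (P - P)) :
    ∑ x, ((‖dualAvg P x‖ ^ 2 : ℝ) : ℂ) * riesz l x * χ x = 0 := by
  induction l generalizing χ with
  | nil =>
    simp only [spanList, Finset.singleton_zero, zero_add] at hχ
    simp only [riesz, Complex.ofReal_one, mul_one, norm_sq_dualAvg_eq_complex]
    have h : ∀ x, (∑ γ ∈ P, ∑ γ' ∈ P, (γ - γ') x) / (P.card : ℂ) ^ 2 * χ x =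
        (∑ γ ∈ P, ∑ γ' ∈ P, (γ - γ' + χ) x) / (P.card : ℂ) ^ 2 := by
      intro x
      rw [div_mul_eq_mul_div, Finset.sum_mul]
      simp_rw [Finset.sum_mul, AddChar.add_apply]
    simp_rw [h]
    rw [← Finset.sum_div, Finset.sum_comm, Finset.sum_eq_zero, zero_div]
    intro γ hγ
    rw [Finset.sum_comm, Finset.sum_eq_zero]
    intro γ' hγ'
    rw [AddChar.sum_eq_ite, if_neg]
    intro h0
    apply hχ
    refine Finset.mem_sub.2 ⟨γ', hγ', γ, hγ, ?_⟩
    rw [eq_comm, ← neg_sub, eq_neg_iff_add_eq_zero, add_comm]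
    exact h0
  | cons γ l ih =>
    rw [spanList] at hχ
    have hmem : ∀ ψ ∈ ({-γ, 0, γ} : Finset (AddChar H ℂ)),
        χ - ψ ∉ spanList l + (P - P) := by
      intro ψ hψ hmem
      obtain ⟨s, hs, d, hd, h⟩ := Finset.mem_add.1 hmem
      refine hχ (Finset.mem_add.2 ⟨s + ψ, Finset.add_mem_add hs hψ, d, hd, ?_⟩)
      rw [add_right_comm, h, sub_add_cancel]
    have h1 := ih (hmem 0 (by simp))
    have h2 := ih (hmem γ (by simp))
    have h3 := ih (hmem (-γ) (by simp))
    have h4 : ∀ x, ((‖dualAvg P x‖ ^ 2 : ℝ) : ℂ) * riesz (γ :: l) x * χ x =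
        ((‖dualAvg P x‖ ^ 2 : ℝ) : ℂ) * riesz l x * (χ - 0) x +
        (1 / 16) * (((‖dualAvg P x‖ ^ 2 : ℝ) : ℂ) * riesz l x * (χ - γ) x) +
        (1 / 16) * (((‖dualAvg P x‖ ^ 2 : ℝ) : ℂ) * riesz l x * (χ - -γ) x) := by
      intro x
      rw [riesz, sub_neg_eq_add, sub_zero, sub_eq_add_neg, AddChar.add_apply, AddChar.add_apply,
        AddChar.neg_apply, AddChar.map_neg_eq_conj]
      push_cast
      have : (((γ x).re : ℂ)) = (γ x + (starRingEnd ℂ) (γ x)) / 2 := by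
        rw [Complex.add_conj]; push_cast; ring
      rw [this]
      ring
    simp_rw [h4]
    rw [Finset.sum_add_distrib, Finset.sum_add_distrib, ← Finset.mul_sum, ← Finset.mul_sum, h1, h2,
      h3]
    ring

theorem sum_dualAvg_mul_riesz {P : Finset (AddChar H ℂ)} (hP : P.Nonempty)
    {l : List (AddChar H ℂ)} (hl : IsDissociated (P - P) l) :
    ∑ x, ‖dualAvg P x‖ ^ 2 * riesz l x = Fintype.card H / P.card := by
  induction l with
  | nil => simpa [riesz] using sum_norm_sq_dualAvg hP
  | cons γ l ih =>
    have h := congrArg Complex.re (sum_dualAvg_mul_riesz_mul_eq_zero P l hl.1)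
    rw [Complex.re_sum] at h
    simp only [← Complex.ofReal_mul, Complex.re_ofReal_mul, Complex.zero_re] at h
    have h2 : ∀ x, ‖dualAvg P x‖ ^ 2 * riesz (γ :: l) x =
        ‖dualAvg P x‖ ^ 2 * riesz l x + (‖dualAvg P x‖ ^ 2 * riesz l x * (γ x).re) / 8 := by
      intro x
      rw [riesz]; ring
    simp_rw [h2]
    rw [Finset.sum_add_distrib, ← Finset.sum_div, h, ih hl.2]
    ring

theorem norm_dualAvg_le_one (P : Finset (AddChar H ℂ)) (x : H) : ‖dualAvg P x‖ ≤ 1 := by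
  rw [dualAvg_eq_ft]
  exact norm_ft_le_one _ _

theorem mul_exp_le_sum_mul_exp {ι : Type*} (s : Finset ι) (w Y : ι → ℝ) (hw : ∀ i ∈ s, 0 ≤ w i)
    {m : ℝ} (hm : m * ∑ i ∈ s, w i ≤ ∑ i ∈ s, w i * Y i) :
    (∑ i ∈ s, w i) * Real.exp m ≤ ∑ i ∈ s, w i * Real.exp (Y i) := by
  have h1 : ∀ i ∈ s, w i * (Real.exp m * (1 + Y i - m)) ≤ w i * Real.exp (Y i) := by
    intro i hi
    refine mul_le_mul_of_nonneg_left ?_ (hw i hi)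
    have h2 := Real.add_one_le_exp (Y i - m)
    have h3 : Real.exp (Y i) = Real.exp m * Real.exp (Y i - m) := by
      rw [← Real.exp_add]; ring_nf
    rw [h3]
    exact mul_le_mul_of_nonneg_left (by linarith) (Real.exp_pos m).le
  refine le_trans ?_ (Finset.sum_le_sum h1)
  have h4 : ∑ i ∈ s, w i * (Real.exp m * (1 + Y i - m)) =
      Real.exp m * (∑ i ∈ s, w i + (∑ i ∈ s, w i * Y i - m * ∑ i ∈ s, w i)) := by
    rw [Finset.mul_sum, ← Finset.sum_sub_distrib, ← Finset.sum_add_distrib, Finset.mul_sum]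
    exact Finset.sum_congr rfl fun i _ => by ring
  rw [h4, mul_comm]
  exact mul_le_mul_of_nonneg_left (by linarith) (Real.exp_pos m).le

/-- The relative form of Chang's theorem: a bound for dissociated lists in a large spectrum. -/
theorem exp_length_le_of_isDissociated {T : Finset H} (hT : T.Nonempty)
    {l : List (AddChar H ℂ)}
    (hl : IsDissociated (largeSpec T (1 / 32) - largeSpec T (1 / 32)) l)
    (hlT : ∀ γ ∈ l, γ ∈ largeSpec T (1 / 2)) :
    Real.exp (l.length / 32) ≤
      2 * (Fintype.card H / (T.card * (largeSpec T (1 / 32)).card)) := by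
  set P := largeSpec T (1 / 32) with hPdef
  have hP : P.Nonempty := ⟨0, zero_mem_largeSpec hT (by norm_num)⟩
  have hP0 : (0 : ℝ) < P.card := by exact_mod_cast hP.card_pos
  have hT0 : (0 : ℝ) < T.card := by exact_mod_cast hT.card_pos
  set w : H × H → ℝ := fun p => ‖dualAvg P (p.1 - p.2)‖ ^ 2 with hw
  have hw0 : ∀ p, 0 ≤ w p := fun p => by positivity
  have hw1 : ∀ p, w p ≤ 1 := fun p =>
    pow_le_one₀ (norm_nonneg _) (norm_dualAvg_le_one P (p.1 - p.2))
  have hre : ∀ γ : AddChar H ℂ, ∑ p ∈ T ×ˢ T, (γ (p.1 - p.2)).re =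
      ‖ft T γ‖ ^ 2 * (T.card : ℝ) ^ 2 := by
    intro γ
    rw [norm_sq_ft_eq_sum_re, div_mul_cancel₀ _ (by positivity), Finset.sum_product]
  have hcard : ∑ p ∈ T ×ˢ T, (1 : ℝ) = (T.card : ℝ) ^ 2 := by
    rw [Finset.sum_const, Finset.card_product]
    push_cast [nsmul_eq_mul]
    ring
  have hs : 7 / 8 * (T.card : ℝ) ^ 2 ≤ ∑ p ∈ T ×ˢ T, w p := by
    simp only [hw, norm_sq_dualAvg_eq]
    rw [← Finset.sum_div, le_div_iff₀ (by positivity), Finset.sum_comm]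
    have h1 : ∀ γ ∈ P, ∀ γ' ∈ P, 7 / 8 * (T.card : ℝ) ^ 2 ≤
        ∑ p ∈ T ×ˢ T, ((γ - γ') (p.1 - p.2)).re := by
      intro γ hγ γ' hγ'
      rw [hre]
      refine mul_le_mul_of_nonneg_right ?_ (by positivity)
      have := mem_largeSpec.1 (sub_largeSpec_subset hT _ (Finset.sub_mem_sub hγ hγ'))
      linarith
    calc 7 / 8 * (T.card : ℝ) ^ 2 * (P.card : ℝ) ^ 2
        = ∑ γ ∈ P, ∑ γ' ∈ P, 7 / 8 * (T.card : ℝ) ^ 2 := by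
          simp only [Finset.sum_const, nsmul_eq_mul]; ring
      _ ≤ _ := by
          refine Finset.sum_le_sum fun γ hγ => ?_
          rw [Finset.sum_comm]
          exact Finset.sum_le_sum fun γ' hγ' => h1 γ hγ γ' hγ'
  have hs1 : ∑ p ∈ T ×ˢ T, w p ≤ (T.card : ℝ) ^ 2 := by
    rw [← hcard]
    exact Finset.sum_le_sum fun p _ => hw1 p
  set Y : H × H → ℝ := fun p => (l.map fun γ => (γ (p.1 - p.2)).re / 8 - 1 / 64).sum with hY
  have hmean : (l.length / 32 : ℝ) * ∑ p ∈ T ×ˢ T, w p ≤ ∑ p ∈ T ×ˢ T, w p * Y p := by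
    have h1 : ∀ γ ∈ largeSpec T (1 / 2), (1 / 32 : ℝ) * (T.card : ℝ) ^ 2 ≤
        ∑ p ∈ T ×ˢ T, w p * ((γ (p.1 - p.2)).re / 8 - 1 / 64) := by
      intro γ hγ
      have h2 : ∑ p ∈ T ×ˢ T, ((γ (p.1 - p.2)).re - (1 - w p)) ≤
          ∑ p ∈ T ×ˢ T, w p * (γ (p.1 - p.2)).re := by
        refine Finset.sum_le_sum fun p _ => ?_
        have := (abs_le.1 (abs_re_le_one γ (p.1 - p.2))).2
        nlinarith [hw1 p]
      rw [Finset.sum_sub_distrib, Finset.sum_sub_distrib, hcard, hre] at h2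
      have h3 := mem_largeSpec.1 hγ
      have h4 : ∑ p ∈ T ×ˢ T, w p * ((γ (p.1 - p.2)).re / 8 - 1 / 64) =
          (∑ p ∈ T ×ˢ T, w p * (γ (p.1 - p.2)).re) / 8 - (∑ p ∈ T ×ˢ T, w p) / 64 := by
        rw [Finset.sum_div, Finset.sum_div, ← Finset.sum_sub_distrib]
        exact Finset.sum_congr rfl fun p _ => by ring
      rw [h4]
      nlinarith [sq_nonneg (T.card : ℝ)]
    have h5 : ∀ l' : List (AddChar H ℂ), (∀ γ ∈ l', γ ∈ largeSpec T (1 / 2)) →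
        (l'.length / 32 : ℝ) * (T.card : ℝ) ^ 2 ≤ ∑ p ∈ T ×ˢ T, w p *
          (l'.map fun γ => (γ (p.1 - p.2)).re / 8 - 1 / 64).sum := by
      intro l'
      induction l' with
      | nil => simp
      | cons γ l' ih =>
        intro h
        have h6 := h1 γ (h γ (by simp))
        have h7 := ih fun γ' hγ' => h γ' (List.mem_cons_of_mem _ hγ')
        simp only [List.map_cons, List.sum_cons, mul_add, Finset.sum_add_distrib,
          List.length_cons]
        push_cast
        linarith
    refine le_trans ?_ (h5 l hlT)
    exact mul_le_mul_of_nonneg_left hs1 (by positivity)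
  have hlow := mul_exp_le_sum_mul_exp (T ×ˢ T) w Y (fun p _ => hw0 p) hmean
  have hriesz0 : ∀ x, 0 ≤ riesz l x := fun x => (Real.exp_pos _).le.trans (exp_le_riesz l x)
  have hup : ∑ p ∈ T ×ˢ T, w p * Real.exp (Y p) ≤ T.card * (Fintype.card H / P.card) := by
    calc ∑ p ∈ T ×ˢ T, w p * Real.exp (Y p)
        ≤ ∑ p ∈ T ×ˢ T, ‖dualAvg P (p.1 - p.2)‖ ^ 2 * riesz l (p.1 - p.2) :=
          Finset.sum_le_sum fun p _ => mul_le_mul_of_nonneg_left (exp_le_riesz l _) (hw0 p)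
      _ = ∑ b ∈ T, ∑ a ∈ T, ‖dualAvg P (a - b)‖ ^ 2 * riesz l (a - b) :=
          Finset.sum_product_right _ _ _
      _ ≤ ∑ b ∈ T, ∑ a, ‖dualAvg P (a - b)‖ ^ 2 * riesz l (a - b) :=
          Finset.sum_le_sum fun b _ => Finset.sum_le_sum_of_subset_of_nonneg (Finset.subset_univ T)
            fun a _ _ => mul_nonneg (by positivity) (hriesz0 _)
      _ = ∑ b ∈ T, (Fintype.card H / P.card : ℝ) := by
          refine Finset.sum_congr rfl fun b _ => ?_
          rw [← sum_dualAvg_mul_riesz hP hl]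
          exact Equiv.sum_comp (Equiv.subRight b) fun x => ‖dualAvg P x‖ ^ 2 * riesz l x
      _ = _ := by rw [Finset.sum_const, nsmul_eq_mul]
  have h1 := (mul_le_mul_of_nonneg_right hs (Real.exp_pos _).le).trans (hlow.trans hup)
  have h2 : Real.exp (l.length / 32) * (T.card : ℝ) ^ 2 ≤
      2 * (T.card * (Fintype.card H / P.card)) := by
    have : 0 ≤ (T.card : ℝ) ^ 2 * Real.exp (l.length / 32) := by positivity
    nlinarith
  rw [← le_div_iff₀ (by positivity)] at h2
  refine h2.trans_eq ?_
  field_simp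

theorem exists_spanList_of_length_le {P Γ : Finset (AddChar H ℂ)} {r : ℕ}
    (h : ∀ l : List (AddChar H ℂ), IsDissociated P l → (∀ γ ∈ l, γ ∈ Γ) → l.length ≤ r) :
    ∃ l : List (AddChar H ℂ), l.length ≤ r ∧ Γ ⊆ spanList l + P := by
  by_contra! hcon
  have key : ∀ k ≤ r + 1, ∃ l : List (AddChar H ℂ), l.length = k ∧ IsDissociated P l ∧
      ∀ γ ∈ l, γ ∈ Γ := by
    intro k
    induction k with
    | zero => exact fun _ => ⟨[], rfl, trivial, by simp⟩
    | succ k ih =>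
      intro hk
      obtain ⟨l, hl, hd, hΓ⟩ := ih (by omega)
      obtain ⟨γ, hγ, hγ'⟩ := Finset.not_subset.1 (hcon l (by omega))
      exact ⟨γ :: l, by simp [hl], ⟨hγ', hd⟩, by simpa using ⟨hγ, hΓ⟩⟩
  obtain ⟨l, hl, hd, hΓ⟩ := key (r + 1) le_rfl
  have := h l hd hΓ
  omega

/-- Polynomial growth of a large spectrum under iterated sums. -/
theorem card_nsmul_largeSpec_le {T : Finset H} (hT : T.Nonempty) {r : ℕ}
    (hr : 2 * (Fintype.card H / (T.card * (largeSpec T (1 / 32)).card) : ℝ) ≤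
      Real.exp (r / 32)) (n : ℕ) :
    ((n + 1) • largeSpec T (1 / 8)).card ≤
      (2 * n + 1) ^ r * (largeSpec T (1 / 8)).card := by
  obtain ⟨l, hl, hsub⟩ := exists_spanList_of_length_le (r := r) (Γ := largeSpec T (1 / 2))
    (P := largeSpec T (1 / 32) - largeSpec T (1 / 32))
    (fun l hd hΓ => by
      have h1 := (exp_length_le_of_isDissociated hT hd hΓ).trans hr
      rw [Real.exp_le_exp] at h1
      have : (l.length : ℝ) ≤ r := by linarith
      exact_mod_cast this)
  have hstep : largeSpec T (1 / 8) + largeSpec T (1 / 8) ⊆ spanList l + largeSpec T (1 / 8) := by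
    refine (add_largeSpec_subset hT _).trans ?_
    rw [show (4 : ℝ) * (1 / 8) = 1 / 2 by norm_num]
    refine hsub.trans (Finset.add_subset_add_left ?_)
    refine (sub_largeSpec_subset hT _).trans_eq ?_
    norm_num
  refine (Finset.card_le_card (nsmul_subset_nsmul_add hstep n)).trans
    (Finset.card_add_le.trans (Nat.mul_le_mul_right _ ?_))
  exact (card_nsmul_spanList_le n l).trans (Nat.pow_le_pow_right (by omega) hl)

end RelativeChang

end SetAddition

namespace SetAddition

section BohrSets

variable {H : Type*} [AddCommGroup H] [Fintype H] [DecidableEq H]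

/-- The Bohr set of points at which all characters in `Γ` are within `ρ` of `1`. -/
noncomputable def bohr (Γ : Finset (AddChar H ℂ)) (ρ : ℝ) : Finset H := by
  classical exact Finset.univ.filter fun x => ∀ γ ∈ Γ, ‖γ x - 1‖ ≤ ρ

theorem mem_bohr {Γ : Finset (AddChar H ℂ)} {ρ : ℝ} {x : H} :
    x ∈ bohr Γ ρ ↔ ∀ γ ∈ Γ, ‖γ x - 1‖ ≤ ρ := by
  simp [bohr]

theorem isSymmNhd_bohr (Γ : Finset (AddChar H ℂ)) {ρ : ℝ} (hρ : 0 ≤ ρ) :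
    IsSymmNhd (bohr Γ ρ) := by
  refine ⟨?_, mem_bohr.2 fun γ _ => by simpa using hρ⟩
  ext x
  rw [Finset.mem_neg', mem_bohr, mem_bohr]
  refine forall₂_congr fun γ _ => ?_
  rw [AddChar.map_neg_eq_conj, ← RCLike.norm_conj, map_sub, map_one, Complex.conj_conj]

theorem nsmul_bohr_subset (Γ : Finset (AddChar H ℂ)) (ρ : ℝ) (m : ℕ) :
    m • bohr Γ ρ ⊆ bohr Γ (m * ρ) := by
  induction m with
  | zero => intro x hx
            simp only [zero_nsmul, Finset.mem_zero] at hx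
            subst hx
            exact mem_bohr.2 fun γ _ => by simp
  | succ m ih =>
    intro x hx
    rw [succ_nsmul] at hx
    obtain ⟨y, hy, z, hz, rfl⟩ := Finset.mem_add.1 hx
    rw [mem_bohr]
    intro γ hγ
    have h1 := mem_bohr.1 (ih hy) γ hγ
    have h2 := mem_bohr.1 hz γ hγ
    have h3 : γ (y + z) - 1 = (γ y - 1) * γ z + (γ z - 1) := by
      rw [AddChar.map_add_eq_mul]; ring
    rw [h3]
    refine (norm_add_le _ _).trans ?_
    rw [norm_mul, AddChar.norm_apply, mul_one]
    push_cast
    linarith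

variable [DecidableEq (AddChar H ℂ)]

theorem norm_apply_sub_one_le {Γ P : Finset (AddChar H ℂ)} (h0 : (0 : AddChar H ℂ) ∈ Γ)
    (hP : P.Nonempty) {δ : ℝ} (hPΓ : ((P + Γ).card : ℝ) ≤ (1 + δ) * P.card) {x : H}
    (hx : 1 / 2 ≤ ‖dualAvg P x‖) {γ : AddChar H ℂ} (hγ : γ ∈ Γ) : ‖γ x - 1‖ ≤ 4 * δ := by
  have hP0 : (0 : ℝ) < P.card := by exact_mod_cast hP.card_pos
  have hbound : ∀ Q ⊆ P + Γ, Q.card = P.card →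
      ‖∑ ψ ∈ P + Γ, ψ x - ∑ ψ ∈ Q, ψ x‖ ≤ δ * P.card := by
    intro Q hQ hcard
    rw [← Finset.sum_sdiff hQ, add_sub_cancel_right]
    refine (norm_sum_le _ _).trans ?_
    simp only [AddChar.norm_apply, Finset.sum_const, nsmul_eq_mul, mul_one]
    rw [Finset.cast_card_sdiff hQ, hcard]
    linarith
  have h1 := hbound P (subset_add_of_zero_mem P h0) rfl
  have h2 := hbound (P + {γ}) (Finset.add_subset_add_left (by simpa using hγ))
    (Finset.card_add_singleton _ _)
  have h3 : ∑ ψ ∈ P + {γ}, ψ x = γ x * ∑ ψ ∈ P, ψ x := by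
    have himage : P + {γ} = P.image (fun ψ => ψ + γ) := by
      ext ψ
      simp only [Finset.mem_add, Finset.mem_image, Finset.mem_singleton, exists_eq_left]
    rw [himage, Finset.sum_image (fun a _ b _ h => add_right_cancel h),
      Finset.mul_sum]
    exact Finset.sum_congr rfl fun ψ _ => by rw [AddChar.add_apply, mul_comm]
  rw [h3] at h2
  have h4 : ‖(γ x - 1) * ∑ ψ ∈ P, ψ x‖ ≤ 2 * (δ * P.card) := by
    have : (γ x - 1) * ∑ ψ ∈ P, ψ x = (∑ ψ ∈ P + Γ, ψ x - ∑ ψ ∈ P, ψ x) -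
        (∑ ψ ∈ P + Γ, ψ x - γ x * ∑ ψ ∈ P, ψ x) := by ring
    rw [this]
    exact (norm_sub_le _ _).trans (by linarith)
  have h5 : ‖∑ ψ ∈ P, ψ x‖ = ‖dualAvg P x‖ * P.card := by
    rw [dualAvg, norm_div, Complex.norm_natCast]
    field_simp
  rw [norm_mul, h5] at h4
  have h6 : ‖γ x - 1‖ * (1 / 2 * P.card) ≤ 2 * (δ * P.card) :=
    le_trans (mul_le_mul_of_nonneg_left (mul_le_mul_of_nonneg_right hx hP0.le) (norm_nonneg _)) h4
  nlinarith

theorem card_div_le_card_filter_dualAvg {P : Finset (AddChar H ℂ)} (hP : P.Nonempty) {q : ℕ}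
    (hq : 1 ≤ q) (h : 2 * ((q • P).card : ℝ) ≤ 4 ^ (q - 1) * P.card) :
    (Fintype.card H : ℝ) / (2 * (q • P).card) ≤
      (Finset.univ.filter fun x : H => 1 / 2 ≤ ‖dualAvg P x‖).card := by
  have hP0 : (0 : ℝ) < P.card := by exact_mod_cast hP.card_pos
  have hq0 : (0 : ℝ) < (q • P).card := by exact_mod_cast hP.nsmul.card_pos
  set X := Finset.univ.filter fun x : H => 1 / 2 ≤ ‖dualAvg P x‖ with hX
  have h1 := card_le_card_nsmul_mul_sum hP q
  have h2 : ∑ x, ‖dualAvg P x‖ ^ (2 * q) ≤ X.card + (1 / 4) ^ (q - 1) * (Fintype.card H / P.card) := by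
    rw [← sum_norm_sq_dualAvg hP, Finset.mul_sum]
    have hXc : (X.card : ℝ) = ∑ x : H, if 1 / 2 ≤ ‖dualAvg P x‖ then (1 : ℝ) else 0 := by
      rw [← Finset.sum_filter]; simp [hX]
    rw [hXc, ← Finset.sum_add_distrib]
    refine Finset.sum_le_sum fun x _ => ?_
    split_ifs with hx
    · have := pow_le_one₀ (norm_nonneg _) (norm_dualAvg_le_one P x) (n := 2 * q)
      have h3 : 0 ≤ (1 / 4 : ℝ) ^ (q - 1) * ‖dualAvg P x‖ ^ 2 := by positivity
      linarith
    · rw [zero_add]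
      have h3 : ‖dualAvg P x‖ ^ (2 * q) = (‖dualAvg P x‖ ^ 2) ^ (q - 1) * ‖dualAvg P x‖ ^ 2 := by
        rw [← pow_succ, ← pow_mul]
        congr 1
        omega
      rw [h3]
      refine mul_le_mul_of_nonneg_right (pow_le_pow_left₀ (by positivity) ?_ _) (by positivity)
      have h4 := (not_le.1 hx).le
      nlinarith [norm_nonneg (dualAvg P x)]
  have h3 : ((q • P).card : ℝ) * ((1 / 4) ^ (q - 1) * (Fintype.card H / P.card)) ≤
      Fintype.card H / 2 := by
    rw [one_div, inv_pow]
    have h4 : (0 : ℝ) < 4 ^ (q - 1) := by positivity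
    rw [show ((q • P).card : ℝ) * (((4 : ℝ) ^ (q - 1))⁻¹ * (Fintype.card H / P.card)) =
      (Fintype.card H * (q • P).card) / (4 ^ (q - 1) * P.card) by field_simp]
    rw [div_le_iff₀ (by positivity)]
    nlinarith [Nat.cast_nonneg (α := ℝ) (Fintype.card H)]
  rw [div_le_iff₀ (by positivity)]
  have h5 := h1.trans (mul_le_mul_of_nonneg_left h2 hq0.le)
  rw [mul_add] at h5
  linarith

theorem sum_compl_largeSpec_le {A T : Finset H} (hA : A.Nonempty) {θ : ℝ} (hθ : θ ≤ 1) (j : ℕ) :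
    ∑ γ ∈ Finset.univ.filter (fun γ : AddChar H ℂ => ¬ 1 - θ ≤ ‖ft T γ‖ ^ 2),
      ‖ft A γ‖ ^ 2 * (‖ft T γ‖ ^ 2) ^ (2 * j) ≤ (1 - θ) ^ (2 * j) * (Fintype.card H / A.card) := by
  rw [← sum_norm_sq_ft hA, Finset.mul_sum]
  refine (Finset.sum_le_sum fun γ hγ => ?_).trans
    (Finset.sum_le_sum_of_subset_of_nonneg (Finset.subset_univ _) fun γ _ _ =>
      mul_nonneg (pow_nonneg (by linarith) _) (by positivity))
  rw [mul_comm]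
  refine mul_le_mul_of_nonneg_right (pow_le_pow_left₀ (by positivity) ?_ _) (by positivity)
  exact (not_le.1 (Finset.mem_filter.1 hγ).2).le

theorem sum_largeSpec_ge {A T : Finset H} (hA : A.Nonempty) (hT : T.Nonempty) {j : ℕ} {κ : ℝ}
    (hκ : 0 < κ) (hcard : ((A + j • (T - T)).card : ℝ) ≤ κ * A.card)
    (hj : (31 / 32 : ℝ) ^ (2 * j) ≤ 1 / (4 * κ)) :
    3 / 4 * (Fintype.card H / (κ * A.card)) ≤
      ∑ γ ∈ largeSpec T (1 / 32), ‖ft A γ‖ ^ 2 * (‖ft T γ‖ ^ 2) ^ (2 * j) ∧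
    ∑ γ ∈ Finset.univ.filter (fun γ : AddChar H ℂ => γ ∉ largeSpec T (1 / 32)),
      ‖ft A γ‖ ^ 2 * (‖ft T γ‖ ^ 2) ^ (2 * j) ≤ 1 / 4 * (Fintype.card H / (κ * A.card)) := by
  have hA0 : (0 : ℝ) < A.card := by exact_mod_cast hA.card_pos
  have hout : ∑ γ ∈ Finset.univ.filter (fun γ : AddChar H ℂ => γ ∉ largeSpec T (1 / 32)),
      ‖ft A γ‖ ^ 2 * (‖ft T γ‖ ^ 2) ^ (2 * j) ≤ 1 / 4 * (Fintype.card H / (κ * A.card)) := by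
    simp only [mem_largeSpec]
    refine (sum_compl_largeSpec_le (T := T) hA (by norm_num) j).trans ?_
    rw [show (1 : ℝ) - 1 / 32 = 31 / 32 by norm_num]
    refine (mul_le_mul_of_nonneg_right hj (by positivity)).trans_eq ?_
    field_simp
  refine ⟨?_, hout⟩
  have h1 := ((realizes_ft hA).mul ((realizes_norm_sq_ft hT).pow j)).card_le
  have h2 : ∀ γ : AddChar H ℂ, ‖ft A γ * (((‖ft T γ‖ ^ 2 : ℝ) : ℂ)) ^ j‖ ^ 2 =
      ‖ft A γ‖ ^ 2 * (‖ft T γ‖ ^ 2) ^ (2 * j) := by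
    intro γ
    rw [norm_mul, norm_pow, Complex.norm_real, Real.norm_of_nonneg (by positivity), mul_pow,
      ← pow_mul, mul_comm j 2]
  simp_rw [h2] at h1
  have h3 := Finset.sum_filter_add_sum_filter_not Finset.univ
    (fun γ : AddChar H ℂ => γ ∈ largeSpec T (1 / 32))
    (fun γ => ‖ft A γ‖ ^ 2 * (‖ft T γ‖ ^ 2) ^ (2 * j))
  rw [Finset.filter_mem_eq_inter, Finset.univ_inter] at h3
  have h4 : (Fintype.card H : ℝ) / (κ * A.card) ≤
      ∑ γ : AddChar H ℂ, ‖ft A γ‖ ^ 2 * (‖ft T γ‖ ^ 2) ^ (2 * j) := by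
    rw [div_le_iff₀ (by positivity), mul_comm]
    exact h1.trans (mul_le_mul_of_nonneg_right hcard
      (Finset.sum_nonneg fun γ _ => by positivity))
  linarith

theorem bohr_subset {A T : Finset H} (hA : A.Nonempty) (hT : T.Nonempty) {j : ℕ} {κ : ℝ}
    (hκ : 0 < κ) (hcard : ((A + j • (T - T)).card : ℝ) ≤ κ * A.card)
    (hj : (31 / 32 : ℝ) ^ (2 * j) ≤ 1 / (4 * κ)) :
    bohr (largeSpec T (1 / 8)) (1 / 2) ⊆ A - A + (2 * j) • (T - T) := by
  have hA0 : (0 : ℝ) < A.card := by exact_mod_cast hA.card_pos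
  have hH0 : (0 : ℝ) < Fintype.card H := by exact_mod_cast Fintype.card_pos
  obtain ⟨hin, hout⟩ := sum_largeSpec_ge hA hT hκ hcard hj
  intro x hx
  refine ((realizes_norm_sq_ft hA).mul ((realizes_norm_sq_ft hT).pow (2 * j))).mem_of_sum_ne_zero ?_
  set w : AddChar H ℂ → ℝ := fun γ => ‖ft A γ‖ ^ 2 * (‖ft T γ‖ ^ 2) ^ (2 * j) with hw
  have hw0 : ∀ γ, 0 ≤ w γ := fun γ => by positivity
  intro h0
  have h1 := congrArg Complex.re h0
  have h2 : ∀ γ : AddChar H ℂ, (((‖ft A γ‖ ^ 2 : ℝ) : ℂ) * (((‖ft T γ‖ ^ 2 : ℝ) : ℂ)) ^ (2 * j) *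
      (starRingEnd ℂ) (γ x)).re = w γ * (γ x).re := by
    intro γ
    rw [← Complex.ofReal_pow, ← Complex.ofReal_mul, Complex.re_ofReal_mul, Complex.conj_re]
  rw [Complex.re_sum, Complex.zero_re] at h1
  simp_rw [h2] at h1
  rw [← Finset.sum_filter_add_sum_filter_not Finset.univ
    (fun γ : AddChar H ℂ => γ ∈ largeSpec T (1 / 32)), Finset.filter_mem_eq_inter,
    Finset.univ_inter] at h1
  have h3 : 1 / 2 * ∑ γ ∈ largeSpec T (1 / 32), w γ ≤
      ∑ γ ∈ largeSpec T (1 / 32), w γ * (γ x).re := by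
    rw [Finset.mul_sum]
    refine Finset.sum_le_sum fun γ hγ => ?_
    have h4 := mem_bohr.1 hx γ (largeSpec_mono T (by norm_num) hγ)
    have h5 := (abs_le.1 ((Complex.abs_re_le_norm _).trans h4)).1
    rw [Complex.sub_re, Complex.one_re] at h5
    nlinarith [hw0 γ]
  have h4 : -∑ γ ∈ Finset.univ.filter (fun γ : AddChar H ℂ => γ ∉ largeSpec T (1 / 32)), w γ ≤
      ∑ γ ∈ Finset.univ.filter (fun γ : AddChar H ℂ => γ ∉ largeSpec T (1 / 32)),
        w γ * (γ x).re := by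
    rw [← Finset.sum_neg_distrib]
    refine Finset.sum_le_sum fun γ _ => ?_
    have h5 := (abs_le.1 ((Complex.abs_re_le_norm _).trans_eq (AddChar.norm_apply γ x))).1
    nlinarith [hw0 γ]
  have h5 : 0 < (Fintype.card H : ℝ) / (κ * A.card) := by positivity
  linarith

theorem exists_le_one_add_mul {b : ℕ → ℕ} {M : ℕ} {δ : ℝ} (hδ : 0 ≤ δ)
    (h : (b M : ℝ) < (1 + δ) ^ M * b 0) : ∃ n < M, (b (n + 1) : ℝ) ≤ (1 + δ) * b n := by
  by_contra! hcon
  have key : ∀ n ≤ M, (1 + δ) ^ n * b 0 ≤ b n := by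
    intro n
    induction n with
    | zero => simp
    | succ n ih =>
      intro hn
      have h1 := ih (by omega)
      have h2 := hcon n (by omega)
      rw [pow_succ]
      nlinarith
  exact absurd (key M le_rfl) (not_le.2 h)

/-- Large multiples of a large Bohr set inside `A - A + 2j(T - T)`. -/
theorem exists_bohr_of_fintype {A T : Finset H} (hA : A.Nonempty) (hT : T.Nonempty) {j : ℕ} {κ : ℝ}
    (hκ : 0 < κ) (hcard : ((A + j • (T - T)).card : ℝ) ≤ κ * A.card)
    (hj : (31 / 32 : ℝ) ^ (2 * j) ≤ 1 / (4 * κ)) {r M q m : ℕ}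
    (hr : 4 * (κ * A.card) ≤ Real.exp (r / 32) * T.card) (hm : 1 ≤ m)
    (hM : (2 * M + 1 : ℝ) ^ r < (1 + 1 / (8 * m)) ^ M) (hq : 1 ≤ q)
    (hqM : 2 * (2 * (q * M) + 1 : ℝ) ^ r ≤ 4 ^ (q - 1)) :
    ∃ X : Finset H, IsSymmNhd X ∧ m • X ⊆ A - A + (2 * j) • (T - T) ∧
      (T.card : ℝ) ≤ 4 * (2 * (q * M) + 1) ^ r * X.card := by
  have hA0 : (0 : ℝ) < A.card := by exact_mod_cast hA.card_pos
  have hT0 : (0 : ℝ) < T.card := by exact_mod_cast hT.card_pos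
  have hH0 : (0 : ℝ) < Fintype.card H := by exact_mod_cast Fintype.card_pos
  have hm0 : (0 : ℝ) < m := by exact_mod_cast hm
  set Γ := largeSpec T (1 / 8) with hΓ
  have h0 : (0 : AddChar H ℂ) ∈ Γ := zero_mem_largeSpec hT (by norm_num)
  have hΓ0 : (0 : ℝ) < Γ.card := by exact_mod_cast Finset.card_pos.2 ⟨0, h0⟩
  have hP : (0 : ℝ) < (largeSpec T (1 / 32)).card := by
    exact_mod_cast Finset.card_pos.2 ⟨0, zero_mem_largeSpec hT (by norm_num)⟩
  have hPcard : (Fintype.card H : ℝ) ≤ 2 * (κ * A.card) * (largeSpec T (1 / 32)).card := by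
    have h1 := (sum_largeSpec_ge hA hT hκ hcard hj).1
    have h2 : ∑ γ ∈ largeSpec T (1 / 32), ‖ft A γ‖ ^ 2 * (‖ft T γ‖ ^ 2) ^ (2 * j) ≤
        (largeSpec T (1 / 32)).card := by
      rw [Finset.card_eq_sum_ones]
      push_cast
      refine Finset.sum_le_sum fun γ _ => ?_
      exact mul_le_one₀ (pow_le_one₀ (norm_nonneg _) (norm_ft_le_one A γ)) (by positivity)
        (pow_le_one₀ (by positivity) (pow_le_one₀ (norm_nonneg _) (norm_ft_le_one T γ)))
    have h3 := h1.trans h2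
    rw [← mul_div_assoc, div_le_iff₀ (by positivity)] at h3
    nlinarith
  have hgrow := card_nsmul_largeSpec_le (r := r) hT (by
    rw [← mul_div_assoc, div_le_iff₀ (by positivity)]
    nlinarith)
  rw [← hΓ] at hgrow
  set δ : ℝ := 1 / (8 * m) with hδ
  have hδ0 : 0 ≤ δ := by positivity
  obtain ⟨n, hnM, hn⟩ := exists_le_one_add_mul (b := fun n => ((n + 1) • Γ).card) (M := M) hδ0 (by
    simp only [zero_add, one_nsmul]
    have h1 : (((M + 1) • Γ).card : ℝ) ≤ (2 * M + 1 : ℝ) ^ r * Γ.card := by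
      exact_mod_cast hgrow M
    exact lt_of_le_of_lt h1 (mul_lt_mul_of_pos_right hM hΓ0))
  set P := (n + 1) • Γ with hPdef
  have hPne : P.Nonempty := ⟨0, zero_mem_nsmul h0 _⟩
  have hΓP : Γ.card ≤ P.card := by
    have := Finset.card_le_card (nsmul_subset_nsmul_of_le h0 (show 1 ≤ n + 1 by omega))
    rwa [one_nsmul] at this
  have hΓP' : (Γ.card : ℝ) ≤ P.card := by exact_mod_cast hΓP
  have hPΓ : ((P + Γ).card : ℝ) ≤ (1 + δ) * P.card := by
    rw [hPdef, ← succ_nsmul]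
    exact hn
  have hqP : ((q • P).card : ℝ) ≤ (2 * (q * M) + 1) ^ r * Γ.card := by
    have h1 : q • P = (q * (n + 1)) • Γ := by rw [hPdef, ← mul_nsmul, mul_comm]
    have h2 : q * (n + 1) ≤ q * M + 1 := by
      have := Nat.mul_le_mul_left q (show n + 1 ≤ M by omega)
      omega
    have h3 : (q • P).card ≤ (2 * (q * M) + 1) ^ r * Γ.card := by
      rw [h1]
      exact (Finset.card_le_card (nsmul_subset_nsmul_of_le h0 h2)).trans (hgrow (q * M))
    exact_mod_cast h3
  have hX := card_div_le_card_filter_dualAvg hPne hq (by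
    calc 2 * ((q • P).card : ℝ) ≤ (2 * (2 * (q * M) + 1) ^ r) * Γ.card := by linarith
      _ ≤ 4 ^ (q - 1) * P.card := mul_le_mul hqM hΓP' (by positivity) (by positivity))
  refine ⟨bohr Γ (1 / (2 * m)), isSymmNhd_bohr Γ (by positivity), ?_, ?_⟩
  · refine (nsmul_bohr_subset Γ _ m).trans ?_
    rw [show (m : ℝ) * (1 / (2 * m)) = 1 / 2 by field_simp]
    exact bohr_subset hA hT hκ hcard hj
  · have h1 : (Finset.univ.filter fun x : H => 1 / 2 ≤ ‖dualAvg P x‖) ⊆ bohr Γ (1 / (2 * m)) := by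
      intro x hx
      refine mem_bohr.2 fun γ hγ => ?_
      refine (norm_apply_sub_one_le h0 hPne hPΓ (Finset.mem_filter.1 hx).2 hγ).trans_eq ?_
      rw [hδ]; field_simp; norm_num
    have h2 : (Fintype.card H : ℝ) / (2 * (q • P).card) ≤ (bohr Γ (1 / (2 * m))).card :=
      hX.trans (by exact_mod_cast Finset.card_le_card h1)
    have hqP0 : (0 : ℝ) < (q • P).card := by exact_mod_cast hPne.nsmul.card_pos
    rw [div_le_iff₀ (by positivity)] at h2
    have h3 := card_largeSpec_le hT (θ := 1 / 8) (by norm_num)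
    rw [← hΓ, ← mul_div_assoc, le_div_iff₀ hT0] at h3
    set x := ((bohr Γ (1 / (2 * m))).card : ℝ)
    have hx0 : 0 ≤ x := Nat.cast_nonneg _
    have h4 : (Γ.card : ℝ) * T.card ≤ Γ.card * (4 * (2 * (q * M) + 1) ^ r * x) := by
      calc (Γ.card : ℝ) * T.card ≤ 2 * Fintype.card H := h3
        _ ≤ 2 * (x * (2 * (q • P).card)) := by linarith
        _ ≤ 2 * (x * (2 * ((2 * (q * M) + 1) ^ r * Γ.card))) := by gcongr
        _ = _ := by ring
    exact le_of_mul_le_mul_left h4 hΓ0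

end BohrSets

end SetAddition

namespace SetAddition

universe u

/-- Finitely generated Abelian groups have finite quotients injective on a given finite set. -/
theorem exists_addMonoidHom_injOn (G : Type u) [AddCommGroup G] [AddGroup.FG G] (E : Finset G) :
    ∃ (F : Type u) (_ : AddCommGroup F) (_ : Fintype F) (φ : G →+ F), Set.InjOn φ E := by
  classical
  obtain ⟨n, ι, hι, p, hp, e, ⟨f⟩⟩ := AddCommGroup.equiv_free_prod_directSum_zmod G
  have : ∀ i, NeZero (p i ^ e i) := fun i => ⟨pow_ne_zero _ (hp i).ne_zero⟩
  set N : ℕ := 1 + ∑ x ∈ E, ∑ i, 2 * ((f x).1 i).natAbs with hN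
  have : NeZero N := ⟨by omega⟩
  let g : (Fin n →₀ ℤ) →+ (Fin n → ZMod N) :=
    { toFun := fun x i => ((x i : ℤ) : ZMod N)
      map_zero' := by ext; simp
      map_add' := fun x y => by ext; simp }
  let F₀ := (Fin n → ZMod N) × (∀ i, ZMod (p i ^ e i))
  let φ₀ : G →+ F₀ :=
    (g.prodMap (DirectSum.addEquivProd fun i => ZMod (p i ^ e i)).toAddMonoidHom).comp
      f.toAddMonoidHom
  have hinj : Set.InjOn φ₀ E := by
    intro x hx y hy hxy
    apply f.injective
    have h1 : g (f x).1 = g (f y).1 := congrArg Prod.fst hxy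
    have h2 : DirectSum.addEquivProd (fun i => ZMod (p i ^ e i)) (f x).2 =
        DirectSum.addEquivProd (fun i => ZMod (p i ^ e i)) (f y).2 := congrArg Prod.snd hxy
    refine Prod.ext (Finsupp.ext fun i => ?_) (AddEquiv.injective _ h2)
    have h3 : (((f x).1 i : ℤ) : ZMod N) = (((f y).1 i : ℤ) : ZMod N) := congrFun h1 i
    rw [ZMod.intCast_eq_intCast_iff_dvd_sub] at h3
    have hb : ∀ z ∈ E, 2 * ((f z).1 i).natAbs < N := by
      intro z hz
      have h4 := Finset.single_le_sum (f := fun i => 2 * ((f z).1 i).natAbs)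
        (fun _ _ => Nat.zero_le _) (Finset.mem_univ i)
      have h5 := Finset.single_le_sum (f := fun x => ∑ i, 2 * ((f x).1 i).natAbs)
        (fun _ _ => Nat.zero_le _) hz
      omega
    have hbx := hb x hx
    have hby := hb y hy
    have h6 := Int.eq_zero_of_abs_lt_dvd h3 (by
      rw [abs_lt]
      constructor <;> omega)
    omega
  refine ⟨ULift.{u} F₀, inferInstance, inferInstance,
    (AddEquiv.ulift (α := F₀)).symm.toAddMonoidHom.comp φ₀, fun x hx y hy hxy => hinj hx hy ?_⟩
  exact (AddEquiv.ulift (α := F₀)).symm.injective hxy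

theorem image_sub_eq {G G' : Type*} [AddCommGroup G] [DecidableEq G] [AddCommGroup G']
    [DecidableEq G'] (φ : G →+ G') (s t : Finset G) :
    (s - t).image φ = s.image φ - t.image φ := by
  rw [sub_eq_add_neg, Finset.image_add, Finset.image_neg, ← sub_eq_add_neg]

/-- A symmetric neighbourhood `X` of relative size at least `1 / E` in `T` with
`mX ⊆ A - A + 2j(T - T)`. -/
def HasDenseRoot {G : Type*} [AddCommGroup G] [DecidableEq G] (A T : Finset G) (j m : ℕ) (E : ℝ) :
    Prop :=
  ∃ X : Finset G, IsSymmNhd X ∧ m • X ⊆ A - A + (2 * j) • (T - T) ∧ (T.card : ℝ) ≤ E * X.card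

theorem HasDenseRoot.of_image {G G' : Type*} [AddCommGroup G] [DecidableEq G] [AddCommGroup G']
    [DecidableEq G'] {A T : Finset G} (hA : A.Nonempty) (hT : T.Nonempty) {j m : ℕ} {E : ℝ}
    (hm : 1 ≤ m) (φ : G →+ G') (hφT : Set.InjOn φ T)
    (hφ : Set.InjOn φ (m • (A - A + (2 * j) • (T - T)) : Finset G))
    (h : HasDenseRoot (A.image φ) (T.image φ) j m E) : HasDenseRoot A T j m E := by
  obtain ⟨Y, ⟨hYs, hY0⟩, hYm, hcard⟩ := h
  set W := A - A + (2 * j) • (T - T) with hW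
  have hself : ∀ S : Finset G, S.Nonempty → (0 : G) ∈ S - S := fun S ⟨s, hs⟩ =>
    Finset.mem_sub.2 ⟨s, hs, s, hs, sub_self s⟩
  have hW0 : (0 : G) ∈ W :=
    Finset.mem_add.2 ⟨0, hself A hA, 0, zero_mem_nsmul (hself T hT) _, add_zero 0⟩
  have hWs : -W = W := by
    rw [hW, neg_add, neg_sub_self, neg_nsmul_eq (neg_sub_self T)]
  have hWm : W ⊆ m • W := by
    have := nsmul_subset_nsmul_of_le hW0 hm
    rwa [one_nsmul] at this
  have himW : (A.image φ) - (A.image φ) + (2 * j) • (T.image φ - T.image φ) = W.image φ := by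
    rw [hW, Finset.image_add, image_sub_eq, Finset.image_nsmul, image_sub_eq]
  rw [himW] at hYm
  set X := W.filter fun w => φ w ∈ Y with hX
  have hXW : X ⊆ W := Finset.filter_subset _ _
  have himX : X.image φ = Y := by
    ext y
    rw [Finset.mem_image]
    constructor
    · rintro ⟨x, hx, rfl⟩
      exact (Finset.mem_filter.1 hx).2
    · intro hy
      have h1 := nsmul_subset_nsmul_of_le hY0 hm
      rw [one_nsmul] at h1
      obtain ⟨w, hw, rfl⟩ := Finset.mem_image.1 (hYm (h1 hy))
      exact ⟨w, Finset.mem_filter.2 ⟨hw, hy⟩, rfl⟩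
  refine ⟨X, ⟨?_, Finset.mem_filter.2 ⟨hW0, by rwa [map_zero]⟩⟩, ?_, ?_⟩
  · ext x
    rw [Finset.mem_neg', hX, Finset.mem_filter, Finset.mem_filter, map_neg, ← Finset.mem_neg',
      ← Finset.mem_neg', hWs, hYs]
  · intro x hx
    have h1 : φ x ∈ m • Y := by
      rw [← himX, ← Finset.image_nsmul]
      exact Finset.mem_image_of_mem φ hx
    obtain ⟨w, hw, hwx⟩ := Finset.mem_image.1 (hYm h1)
    have h2 := hφ (by exact_mod_cast hWm hw)
      (by exact_mod_cast Finset.nsmul_subset_nsmul_left hXW hx) hwx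
    rwa [← h2]
  · rw [Finset.card_image_of_injOn hφT, ← himX] at hcard
    refine hcard.trans_eq ?_
    rw [Finset.card_image_of_injOn]
    exact hφ.mono (by exact_mod_cast hXW.trans hWm)

theorem HasDenseRoot.image {G G' : Type*} [AddCommGroup G] [DecidableEq G] [AddCommGroup G']
    [DecidableEq G'] {A T : Finset G} {j m : ℕ} {E : ℝ} (φ : G →+ G') (hφ : Function.Injective φ)
    (h : HasDenseRoot A T j m E) : HasDenseRoot (A.image φ) (T.image φ) j m E := by
  obtain ⟨X, ⟨hs, h0⟩, hm, hcard⟩ := h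
  refine ⟨X.image φ, ⟨?_, Finset.mem_image.2 ⟨0, h0, map_zero φ⟩⟩, ?_, ?_⟩
  · rw [← Finset.image_neg, hs]
  · rw [← Finset.image_nsmul, ← image_sub_eq, ← image_sub_eq, ← Finset.image_nsmul,
      ← Finset.image_add]
    exact Finset.image_subset_image hm
  · rwa [Finset.card_image_of_injective _ hφ, Finset.card_image_of_injective _ hφ]

/-- Large sets with many sums inside `A - A + 2j(T - T)`, in arbitrary Abelian groups. -/
theorem hasDenseRoot {G : Type u} [AddCommGroup G] [DecidableEq G] {A T : Finset G}
    (hA : A.Nonempty) (hT : T.Nonempty) {j : ℕ} {κ : ℝ} (hκ : 0 < κ)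
    (hcard : ((A + j • (T - T)).card : ℝ) ≤ κ * A.card)
    (hj : (31 / 32 : ℝ) ^ (2 * j) ≤ 1 / (4 * κ)) {r M q m : ℕ}
    (hr : 4 * (κ * A.card) ≤ Real.exp (r / 32) * T.card) (hm : 1 ≤ m)
    (hM : (2 * M + 1 : ℝ) ^ r < (1 + 1 / (8 * m)) ^ M) (hq : 1 ≤ q)
    (hqM : 2 * (2 * (q * M) + 1 : ℝ) ^ r ≤ 4 ^ (q - 1)) :
    HasDenseRoot A T j m (4 * (2 * (q * M) + 1) ^ r) := by
  classical
  let S := AddSubgroup.closure ((A ∪ T : Finset G) : Set G)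
  have hAS : ∀ a ∈ A, a ∈ S := fun a ha =>
    AddSubgroup.subset_closure (by simpa using Or.inl ha)
  have hTS : ∀ t ∈ T, t ∈ S := fun t ht =>
    AddSubgroup.subset_closure (by simpa using Or.inr ht)
  have hinj : Function.Injective S.subtype := Subtype.val_injective
  set A' := A.preimage S.subtype hinj.injOn with hA'
  set T' := T.preimage S.subtype hinj.injOn with hT'
  have hAim : A'.image S.subtype = A := by
    rw [hA', Finset.image_preimage, Finset.filter_true_of_mem]
    exact fun a ha => ⟨⟨a, hAS a ha⟩, rfl⟩
  have hTim : T'.image S.subtype = T := by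
    rw [hT', Finset.image_preimage, Finset.filter_true_of_mem]
    exact fun t ht => ⟨⟨t, hTS t ht⟩, rfl⟩
  have hA'ne : A'.Nonempty := by rw [← hAim] at hA; exact hA.of_image
  have hT'ne : T'.Nonempty := by rw [← hTim] at hT; exact hT.of_image
  have hAc : A.card = A'.card := by rw [← hAim, Finset.card_image_of_injective _ hinj]
  have hTc : T.card = T'.card := by rw [← hTim, Finset.card_image_of_injective _ hinj]
  have hsum : (A + j • (T - T)).card = (A' + j • (T' - T')).card := by
    rw [← hAim, ← hTim, ← image_sub_eq, ← Finset.image_nsmul, ← Finset.image_add,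
      Finset.card_image_of_injective _ hinj]
  rw [hAc, hTc] at hr
  rw [hAc, hsum] at hcard
  rw [← hAim, ← hTim]
  refine HasDenseRoot.image S.subtype hinj ?_
  have : AddGroup.FG S := by
    rw [AddGroup.fg_iff_addSubgroup_fg]
    exact ⟨A ∪ T, rfl⟩
  obtain ⟨F, _, _, φ, hφ⟩ := exists_addMonoidHom_injOn S
    (A' ∪ T' ∪ m • (A' - A' + (2 * j) • (T' - T')))
  have hφA : Set.InjOn φ A' := hφ.mono (by
    intro x hx; simp only [Finset.coe_union]; exact Or.inl (Or.inl hx))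
  have hφT : Set.InjOn φ T' := hφ.mono (by
    intro x hx; simp only [Finset.coe_union]; exact Or.inl (Or.inr hx))
  refine HasDenseRoot.of_image hA'ne hT'ne hm φ hφT (hφ.mono (by
    intro x hx; rw [Finset.coe_union]; exact Or.inr hx)) ?_
  refine exists_bohr_of_fintype (hA'ne.image φ) (hT'ne.image φ) hκ ?_ hj ?_ hm hM hq hqM
  · rw [Finset.card_image_of_injOn hφA, ← image_sub_eq, ← Finset.image_nsmul,
      ← Finset.image_add]
    exact le_trans (by exact_mod_cast Finset.card_image_le) hcard
  · rwa [Finset.card_image_of_injOn hφA, Finset.card_image_of_injOn hφT]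

end SetAddition

namespace SetAddition

universe u

theorem growth_parameters {r v : ℕ} (hr : 1 ≤ r) (hv : 1 ≤ v) (hrv : r ≤ 2 ^ v) :
    (2 * (2 ^ (40 * v) : ℕ) + 1 : ℝ) ^ r <
      (1 + 1 / (8 * (6 * (100 * r * v) + 2 : ℕ))) ^ (2 ^ (40 * v)) ∧
    2 * (2 * ((2 ^ (20 * v) : ℕ) * (2 ^ (40 * v) : ℕ)) + 1 : ℝ) ^ r ≤ 4 ^ (2 ^ (20 * v) - 1) ∧
    4 * (2 * ((2 ^ (20 * v) : ℕ) * (2 ^ (40 * v) : ℕ)) + 1 : ℝ) ^ r * Real.exp (r / 32) <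
      2 ^ (100 * r * v) := by
  have hrv2 : r * v ≤ 2 ^ (2 * v) := by
    rw [two_mul, pow_add]
    exact Nat.mul_le_mul hrv v.lt_two_pow_self.le
  have hrv1 : 1 ≤ r * v := Nat.mul_pos hr hv
  have hrle : r ≤ r * v := Nat.le_mul_of_pos_right r hv
  have h64 : 64 * (r * v) ≤ 2 ^ (8 * v) := by
    calc 64 * (r * v) ≤ 2 ^ 6 * 2 ^ (2 * v) := Nat.mul_le_mul (by norm_num) hrv2
      _ = 2 ^ (6 + 2 * v) := by rw [pow_add]
      _ ≤ 2 ^ (8 * v) := Nat.pow_le_pow_right (by norm_num) (by omega)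
  have hpow : ∀ a : ℕ, (2 * 2 ^ (a * v) + 1) ^ r ≤ 2 ^ ((a + 2) * (r * v)) := by
    intro a
    calc (2 * 2 ^ (a * v) + 1) ^ r ≤ (2 ^ ((a + 2) * v)) ^ r := by
          refine Nat.pow_le_pow_left ?_ r
          have h1 : 2 ^ (a * v) * 2 ^ 2 ≤ 2 ^ ((a + 2) * v) := by
            rw [← pow_add]
            refine Nat.pow_le_pow_right (by norm_num) ?_
            rw [add_mul]; omega
          have h2 : 1 ≤ 2 ^ (a * v) := Nat.one_le_two_pow
          omega
      _ = _ := by rw [← pow_mul]; congr 1; ring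
  have hbig : (2 * ((2 ^ (20 * v) : ℕ) * (2 ^ (40 * v) : ℕ)) + 1 : ℝ) ^ r ≤
      2 ^ (62 * (r * v)) := by
    have h1 := hpow 60
    rw [show 60 * v = 20 * v + 40 * v by ring, pow_add] at h1
    exact_mod_cast h1
  refine ⟨?_, ?_, ?_⟩
  · set m := 6 * (100 * r * v) + 2 with hm
    have hm0 : (0 : ℝ) < m := by rw [hm]; positivity
    have hM : 8 * m * 2 ^ (25 * v) ≤ 2 ^ (40 * v) := by
      have h1 : 8 * m ≤ 2 ^ 13 * 2 ^ (2 * v) := by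
        have : m = 600 * (r * v) + 2 := by rw [hm]; ring
        omega
      calc 8 * m * 2 ^ (25 * v) ≤ 2 ^ 13 * 2 ^ (2 * v) * 2 ^ (25 * v) := Nat.mul_le_mul_right _ h1
        _ = 2 ^ (13 + 2 * v + 25 * v) := by rw [pow_add, pow_add]
        _ ≤ _ := Nat.pow_le_pow_right (by norm_num) (by omega)
    have h2 : (2 : ℝ) ≤ (1 + 1 / (8 * m)) ^ (8 * m) := by
      have h3 := one_add_mul_le_pow (a := 1 / (8 * (m : ℝ)))
        (le_trans (by norm_num) (by positivity : (0 : ℝ) ≤ 1 / (8 * (m : ℝ)))) (8 * m)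
      refine le_trans (le_of_eq ?_) h3
      push_cast
      field_simp
      norm_num
    calc (2 * (2 ^ (40 * v) : ℕ) + 1 : ℝ) ^ r ≤ 2 ^ (42 * (r * v)) := by exact_mod_cast hpow 40
      _ < 2 ^ (2 ^ (25 * v)) := by
          refine pow_lt_pow_right₀ (by norm_num) ?_
          have h4 : 2 ^ (8 * v) ≤ 2 ^ (25 * v) := Nat.pow_le_pow_right (by norm_num) (by omega)
          omega
      _ ≤ ((1 + 1 / (8 * m)) ^ (8 * m)) ^ (2 ^ (25 * v)) := pow_le_pow_left₀ (by norm_num) h2 _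
      _ = (1 + 1 / (8 * m)) ^ (8 * m * 2 ^ (25 * v)) := (pow_mul _ _ _).symm
      _ ≤ _ := pow_le_pow_right₀ (by
          have : (0 : ℝ) ≤ 1 / (8 * m) := by positivity
          linarith) hM
  · calc 2 * (2 * ((2 ^ (20 * v) : ℕ) * (2 ^ (40 * v) : ℕ)) + 1 : ℝ) ^ r
        ≤ 2 * 2 ^ (62 * (r * v)) := by linarith
      _ = 2 ^ (62 * (r * v) + 1) := by rw [pow_succ]; ring
      _ ≤ 2 ^ (2 * (2 ^ (20 * v) - 1)) := by
          refine pow_le_pow_right₀ (by norm_num) ?_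
          have h1 : 2 ^ (8 * v) ≤ 2 ^ (20 * v) := Nat.pow_le_pow_right (by norm_num) (by omega)
          omega
      _ = _ := by rw [pow_mul]; norm_num
  · have hexp : Real.exp (r / 32) ≤ 2 ^ r := by
      have h1 : Real.exp (r / 32) = Real.exp (1 / 32) ^ r := by
        rw [← Real.exp_nat_mul]; ring_nf
      rw [h1]
      refine pow_le_pow_left₀ (Real.exp_pos _).le ?_ r
      rw [← Real.le_log_iff_exp_le (by norm_num)]
      linarith [Real.log_two_gt_d9]
    calc 4 * (2 * ((2 ^ (20 * v) : ℕ) * (2 ^ (40 * v) : ℕ)) + 1 : ℝ) ^ r * Real.exp (r / 32)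
        ≤ 4 * 2 ^ (62 * (r * v)) * 2 ^ r := by gcongr
      _ = 2 ^ (2 + 62 * (r * v) + r) := by rw [pow_add, pow_add]; norm_num
      _ < _ := by
          refine pow_lt_pow_right₀ (by norm_num) ?_
          rw [mul_assoc]
          omega

theorem natLog_add_one_le {η L c : ℝ} (hη : 0 < η) (hη1 : η ≤ 1) (hL : 1 ≤ L) (hc : 0 ≤ c) {r : ℕ}
    (hr : 1 ≤ r) (hrL : (r : ℝ) ≤ c * L ^ (3 + η / 2)) :
    (Nat.log 2 r : ℝ) + 1 ≤ (1 + 2 * (c ^ (η / 8) / (η / 8))) * L ^ (η / 2) := by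
  have hL0 : 0 < L := by linarith
  have h1 : (2 : ℝ) ^ (Nat.log 2 r) ≤ r := by
    exact_mod_cast Nat.pow_log_le_self 2 (by omega)
  have h2 := Real.log_le_log (by positivity) h1
  rw [Real.log_pow] at h2
  have h3 : Real.log r ≤ (r : ℝ) ^ (η / 8) / (η / 8) :=
    Real.log_le_rpow_div (Nat.cast_nonneg r) (by linarith)
  have hYL : L ^ (3 + η / 2) ≤ L ^ (4 : ℝ) := Real.rpow_le_rpow_of_exponent_le hL (by linarith)
  have h4 : (r : ℝ) ^ (η / 8) ≤ c ^ (η / 8) * L ^ (η / 2) := by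
    calc (r : ℝ) ^ (η / 8) ≤ (c * L ^ (4 : ℝ)) ^ (η / 8) := by
          refine Real.rpow_le_rpow (Nat.cast_nonneg r) (hrL.trans ?_) (by linarith)
          exact mul_le_mul_of_nonneg_left hYL hc
      _ = _ := by
          rw [Real.mul_rpow hc (by positivity), ← Real.rpow_mul hL0.le]
          ring_nf
  have h5 : (r : ℝ) ^ (η / 8) / (η / 8) ≤ c ^ (η / 8) / (η / 8) * L ^ (η / 2) := by
    rw [div_mul_eq_mul_div]
    exact div_le_div_of_nonneg_right h4 (by linarith)
  have h6 : 1 ≤ L ^ (η / 2) := Real.one_le_rpow hL (by linarith)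
  have h7 : (Nat.log 2 r : ℝ) ≤ 2 * (c ^ (η / 8) / (η / 8) * L ^ (η / 2)) := by
    have := Real.log_two_gt_d9
    have : (0 : ℝ) ≤ Nat.log 2 r := Nat.cast_nonneg _
    nlinarith
  linarith

set_option maxHeartbeats 400000 in
/-- The structure theorem with a loss of `η` in the exponent. -/
theorem exists_relPolyGrowth {η : ℝ} (hη : 0 < η) (hη1 : η ≤ 1) :
    ∃ C : ℝ, 1 ≤ C ∧ ∀ (G : Type u) [AddCommGroup G] [DecidableEq G] (A : Finset G) (L : ℝ), 1 ≤ L →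
      A.Nonempty → ((A + A).card : ℝ) ≤ Real.exp L * A.card →
      ∃ X : Finset G, IsSymmNhd X ∧ IsCoveredBy (Real.exp (C * L ^ (3 + η))) A X ∧
        (X.card : ℝ) ≤ Real.exp (C * L ^ (1 + η)) * A.card ∧
        HasRelPolyGrowth (C * L ^ (3 + η)) X := by
  obtain ⟨N, hN⟩ := exists_hasLargeRoots.{u} (η := η / 2) (by linarith) (by linarith)
  obtain ⟨C₀, hroots⟩ := hN (64 * (2 * N + 1) + 200) (by
    have := Nat.cast_nonneg (α := ℝ) N; linarith)
  set C₁ : ℝ := 32 * (max C₀ 0 + 2 * N + 10) with hC₁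
  have hC₁1 : 1 ≤ C₁ := by
    have := Nat.cast_nonneg (α := ℝ) N
    have := le_max_right C₀ 0
    linarith
  set C₂ : ℝ := 1 + 2 * ((2 * C₁) ^ (η / 8) / (η / 8)) with hC₂
  have hC₂0 : 1 ≤ C₂ := by
    have : 0 ≤ (2 * C₁) ^ (η / 8) / (η / 8) := by positivity
    linarith
  refine ⟨400 * (2 * C₁) * C₂ + (2 * N + 3), by
    have := Nat.cast_nonneg (α := ℝ) N
    nlinarith, ?_⟩
  intro G _ _ A L hL hA hAA
  have hL0 : 0 < L := by linarith
  have hN0 : (0 : ℝ) ≤ N := Nat.cast_nonneg N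
  have hA0 : (0 : ℝ) < A.card := by exact_mod_cast hA.card_pos
  obtain ⟨T, k, ⟨hTs, hT0⟩, hk, hkT, hTcard⟩ := hroots G A L hL hA hAA
  rw [Real.rpow_one] at hk
  have hTpos : (0 : ℝ) < T.card := by exact_mod_cast Finset.card_pos.2 ⟨0, hT0⟩
  set Y := L ^ (3 + η / 2) with hY
  have hLY : L ≤ Y := by
    calc L = L ^ (1 : ℝ) := (Real.rpow_one L).symm
      _ ≤ Y := Real.rpow_le_rpow_of_exponent_le hL (by linarith)
  set x : ℝ := 16 * ((2 * N + 1) * L + 2) with hx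
  have hx0 : 0 ≤ x := by positivity
  set j := ⌈x⌉₊ with hj
  have hjx : x ≤ j := Nat.le_ceil x
  have hjx2 : (j : ℝ) ≤ x + 1 := (Nat.ceil_lt_add_one hx0).le
  have h4j : 4 * j ≤ k := by
    have : (4 * j : ℝ) ≤ k := by
      refine le_trans ?_ hk
      nlinarith
    exact_mod_cast this
  have hTT : T - T = 2 • T := by rw [sub_eq_add_neg, hTs, two_nsmul]
  have hsubN : ∀ i ≤ 2 * j, i • (T - T) ⊆ N • (A - A) := by
    intro i hi
    rw [hTT, ← mul_nsmul]
    exact (nsmul_subset_nsmul_of_le hT0 (by omega)).trans hkT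
  set κ := Real.exp ((2 * N + 1) * L) with hκ
  have hκ0 : 0 < κ := Real.exp_pos _
  have hκcard : ((A + j • (T - T)).card : ℝ) ≤ κ * A.card := by
    refine le_trans ?_ (card_add_nsmul_sub_le hA hAA N)
    exact_mod_cast Finset.card_le_card (Finset.add_subset_add_left (hsubN j (by omega)))
  have hjκ : (31 / 32 : ℝ) ^ (2 * j) ≤ 1 / (4 * κ) := by
    have h1 : (31 / 32 : ℝ) ≤ Real.exp (-(1 / 32)) := by
      have := Real.add_one_le_exp (-(1 / 32 : ℝ))
      linarith
    refine (pow_le_pow_left₀ (by norm_num) h1 _).trans ?_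
    rw [← Real.exp_nat_mul, one_div (4 * κ), ← Real.exp_log (show (0 : ℝ) < 4 by norm_num), hκ,
      ← Real.exp_add, ← Real.exp_neg, Real.exp_le_exp]
    have h2 : Real.log 4 ≤ 2 := by
      rw [show (4 : ℝ) = 2 ^ 2 by norm_num, Real.log_pow]
      have := Real.log_two_lt_d9
      push_cast
      linarith
    push_cast
    linarith
  set r := ⌈C₁ * Y⌉₊ with hr
  have hY1 : 1 ≤ Y := hL.trans hLY
  have hC₁Y : 1 ≤ C₁ * Y := by nlinarith
  have hrge : C₁ * Y ≤ r := Nat.le_ceil _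
  have hrle : (r : ℝ) ≤ 2 * C₁ * Y := by
    have := Nat.ceil_lt_add_one (zero_le_one.trans hC₁Y)
    linarith
  have hr1 : 1 ≤ r := by exact_mod_cast hC₁Y.trans hrge
  clear_value r
  have hexpr : ∀ a : ℝ, a ≤ (2 * N + 10) * Y → Real.exp a * A.card ≤ Real.exp (r / 32) * T.card := by
    intro a ha
    calc Real.exp a * A.card ≤ Real.exp a * (Real.exp (C₀ * Y) * T.card) := by gcongr
      _ = Real.exp (a + C₀ * Y) * T.card := by rw [Real.exp_add]; ring
      _ ≤ _ := by
          refine mul_le_mul_of_nonneg_right (Real.exp_le_exp.2 ?_) hTpos.le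
          have h1 : C₀ * Y ≤ max C₀ 0 * Y :=
            mul_le_mul_of_nonneg_right (le_max_left _ _) (by linarith)
          have h2 : C₁ * Y = 32 * (max C₀ 0 * Y + (2 * N + 10) * Y) := by rw [hC₁]; ring
          linarith
  have hNL : (N : ℝ) * L ≤ N * Y := mul_le_mul_of_nonneg_left hLY hN0
  have hrcond : 4 * (κ * A.card) ≤ Real.exp (r / 32) * T.card := by
    refine le_trans ?_ (hexpr (4 + (2 * N + 1) * L) (by nlinarith))
    rw [Real.exp_add, ← mul_assoc]
    refine mul_le_mul_of_nonneg_right (mul_le_mul_of_nonneg_right ?_ hκ0.le) hA0.le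
    linarith [Real.add_one_le_exp (4 : ℝ)]
  set v := Nat.log 2 r + 1 with hv
  have hrv : r ≤ 2 ^ v := (Nat.lt_pow_succ_log_self (by norm_num) r).le
  obtain ⟨hM, hqM, hd⟩ := growth_parameters hr1 (show 1 ≤ v by omega) hrv
  clear_value v
  set d := 100 * r * v with hdef
  clear_value d
  have hd1 : 1 ≤ d := by
    have : 0 < r * v := Nat.mul_pos hr1 (by omega)
    rw [hdef, mul_assoc]
    omega
  obtain ⟨X, ⟨hXs, hX0⟩, hmX, hXcard⟩ := hasDenseRoot hA ⟨0, hT0⟩ hκ0 hκcard hjκ hrcond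
    (m := 6 * d + 2) (by omega) hM Nat.one_le_two_pow hqM
  have hW : A - A + (2 * j) • (T - T) ⊆ (N + 1) • (A - A) := by
    rw [succ_nsmul']
    exact Finset.add_subset_add_left (hsubN _ le_rfl)
  have hmXN : (6 * d + 2) • X ⊆ (N + 1) • (A - A) := hmX.trans hW
  have hXpos : (0 : ℝ) < X.card := by exact_mod_cast Finset.card_pos.2 ⟨0, hX0⟩
  have hmain : Real.exp ((2 * (N + 1 : ℕ) + 1) * L) * A.card < 2 ^ d * X.card := by
    refine (hexpr _ (by push_cast; nlinarith)).trans_lt ?_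
    calc Real.exp (r / 32) * T.card
        ≤ Real.exp (r / 32) * (4 * (2 * ((2 ^ (20 * v) : ℕ) * (2 ^ (40 * v) : ℕ)) + 1 : ℝ) ^ r *
            X.card) := mul_le_mul_of_nonneg_left hXcard (Real.exp_pos _).le
      _ = 4 * (2 * ((2 ^ (20 * v) : ℕ) * (2 ^ (40 * v) : ℕ)) + 1 : ℝ) ^ r *
            Real.exp (r / 32) * X.card := by ring
      _ < _ := mul_lt_mul_of_pos_right hd hXpos
  have hdC : 4 * (d : ℝ) ≤ (400 * (2 * C₁) * C₂ + (2 * N + 3)) * L ^ (3 + η) := by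
    have hvle : (v : ℝ) ≤ C₂ * L ^ (η / 2) := by
      have h1 := natLog_add_one_le hη hη1 hL (by linarith : 0 ≤ 2 * C₁) hr1 hrle
      rw [hv]
      push_cast
      exact h1
    have hYY : L ^ (3 + η) = Y * L ^ (η / 2) := by
      rw [hY, ← Real.rpow_add hL0]; ring_nf
    have h1 : 0 ≤ (2 * N + 3) * L ^ (3 + η) :=
      mul_nonneg (by linarith) (Real.rpow_nonneg hL0.le _)
    calc 4 * (d : ℝ) = 400 * (r * v) := by rw [hdef]; push_cast; ring
      _ ≤ 400 * ((2 * C₁ * Y) * (C₂ * L ^ (η / 2))) := by gcongr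
      _ = 400 * (2 * C₁) * C₂ * L ^ (3 + η) := by rw [hYY]; ring
      _ ≤ _ := by linarith
  have hX2s : -((2 : ℕ) • X) = (2 : ℕ) • X := neg_nsmul_eq hXs 2
  have hX20 : (0 : G) ∈ (2 : ℕ) • X := zero_mem_nsmul hX0 2
  have hXX2 : X ⊆ (2 : ℕ) • X := by
    have := nsmul_subset_nsmul_of_le hX0 (show 1 ≤ 2 by norm_num)
    rwa [one_nsmul] at this
  have hXN : ∀ i ≤ 2, i • X ⊆ (N + 1) • (A - A) := fun i hi =>
    (nsmul_subset_nsmul_of_le hX0 (by omega)).trans hmXN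
  have hLη : L ≤ L ^ (1 + η) := by
    calc L = L ^ (1 : ℝ) := (Real.rpow_one L).symm
      _ ≤ _ := Real.rpow_le_rpow_of_exponent_le hL (by linarith)
  refine ⟨2 • X, ⟨hX2s, hX20⟩, ?_, ?_, ?_⟩
  · have hcov : ((A + X).card : ℝ) ≤ 2 ^ d * X.card := by
      refine le_trans ?_ hmain.le
      refine le_trans ?_ (card_add_nsmul_sub_le hA hAA (N + 1))
      have := hXN 1 (by norm_num)
      rw [one_nsmul] at this
      exact_mod_cast Finset.card_le_card (Finset.add_subset_add_left this)
    obtain ⟨F, -, hF, hAF⟩ := Finset.ruzsa_covering_add ⟨0, hX0⟩ hcov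
    refine ⟨F, hF.trans ?_, ?_⟩
    · calc (2 : ℝ) ^ d ≤ Real.exp 1 ^ d := by
            refine pow_le_pow_left₀ (by norm_num) ?_ d
            linarith [Real.add_one_le_exp (1 : ℝ)]
        _ = Real.exp d := by rw [← Real.exp_nat_mul, mul_one]
        _ ≤ _ := Real.exp_le_exp.2 (by linarith [Nat.cast_nonneg (α := ℝ) d])
    · rwa [sub_eq_add_neg, hXs, ← two_nsmul] at hAF
  · calc ((2 • X).card : ℝ) ≤ ((N + 1) • (A - A)).card := by
          exact_mod_cast Finset.card_le_card (hXN 2 le_rfl)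
      _ ≤ Real.exp ((2 * (N + 1 : ℕ) + 1) * L) * A.card := card_nsmul_sub_le hA hAA (N + 1)
      _ ≤ _ := by
          refine mul_le_mul_of_nonneg_right (Real.exp_le_exp.2 ?_) hA0.le
          push_cast
          have h1 : 0 ≤ 400 * (2 * C₁) * C₂ * L ^ (1 + η) := by positivity
          nlinarith
  · refine hasRelPolyGrowth_of_card_lt ⟨hX2s, hX20⟩ hd1 ?_ hdC
    have h1 : (3 * d + 1) • 2 • X = (6 * d + 2) • X := by
      rw [← mul_nsmul]; congr 1; ring
    rw [h1]
    have h2 : (((6 * d + 2) • X).card : ℝ) < 2 ^ d * X.card := by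
      refine lt_of_le_of_lt ?_ hmain
      refine le_trans ?_ (card_nsmul_sub_le hA hAA (N + 1))
      exact_mod_cast Finset.card_le_card hmXN
    have h3 : ((6 * d + 2) • X).card < 2 ^ d * X.card := by exact_mod_cast h2
    exact h3.trans_le (Nat.mul_le_mul_left _ (Finset.card_le_card hXX2))

/-- Diagonalisation over a sequence of exponents: losses `C i * L ^ (1 / (i + 1))` are absorbed in a
single `L ^ ε` with `ε` tending to `0`. -/
theorem exists_tendsto_zero_exponent (C : ℕ → ℝ) (hC : ∀ i, 1 ≤ C i) :
    ∃ ε : ℝ → ℝ, Tendsto ε atTop (𝓝 0) ∧ ∀ K, 1 ≤ K → ∃ i : ℕ, ∀ a : ℝ,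
      C i * Real.log (2 + K) ^ (a + 1 / ((i : ℝ) + 1)) = Real.log (2 + K) ^ (a + ε K) := by
  set f : ℝ → ℕ → ℝ := fun K i =>
    1 / ((i : ℝ) + 1) + Real.log (C i) / Real.log (Real.log (2 + K)) with hf
  have hne : ∀ K : ℝ, (Finset.range (⌈K⌉₊ + 1)).Nonempty := fun K => ⟨0, by simp⟩
  have hlog : ∀ K : ℝ, 1 ≤ K → 1 < Real.log (2 + K) := by
    intro K hK
    rw [Real.lt_log_iff_exp_lt (by linarith)]
    linarith [Real.exp_one_lt_d9]
  have htend : Tendsto (fun K : ℝ => Real.log (Real.log (2 + K))) atTop atTop :=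
    Real.tendsto_log_atTop.comp (Real.tendsto_log_atTop.comp (tendsto_atTop_add_const_left _ 2
      tendsto_id))
  refine ⟨fun K => (Finset.range (⌈K⌉₊ + 1)).inf' (hne K) (f K), ?_, fun K hK => ?_⟩
  · rw [Metric.tendsto_atTop']
    intro δ hδ
    obtain ⟨i, hi⟩ := exists_nat_one_div_lt (show 0 < δ / 2 by linarith)
    have h1 : Tendsto (fun K : ℝ => Real.log (C i) / Real.log (Real.log (2 + K))) atTop (𝓝 0) :=
      htend.const_div_atTop _
    obtain ⟨K₀, hK₀⟩ := Filter.eventually_atTop.1 (h1.eventually_lt_const (show 0 < δ / 2 by linarith))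
    refine ⟨max K₀ (max i 1), fun K hK => ?_⟩
    have hKi : (i : ℝ) ≤ K := ((le_max_left _ _).trans (le_max_right _ _)).trans hK.le
    have hK1 : 1 ≤ K := ((le_max_right _ _).trans (le_max_right _ _)).trans hK.le
    have hKK : K₀ ≤ K := (le_max_left _ _).trans hK.le
    rw [Real.dist_eq, sub_zero, abs_lt]
    constructor
    · refine lt_of_lt_of_le (neg_lt_zero.2 hδ) ((Finset.le_inf'_iff _ _).2 fun b _ => ?_)
      have h2 : 0 ≤ Real.log (C b) / Real.log (Real.log (2 + K)) :=
        div_nonneg (Real.log_nonneg (hC b)) (Real.log_nonneg (hlog K hK1).le)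
      have h3 : (0 : ℝ) ≤ 1 / ((b : ℝ) + 1) := by positivity
      simp only [hf]
      linarith
    · refine lt_of_le_of_lt (Finset.inf'_le _ (b := i) ?_) ?_
      · rw [Finset.mem_range, Nat.lt_succ_iff]
        exact_mod_cast hKi.trans (Nat.le_ceil K)
      · have h2 := hK₀ K hKK
        simp only [hf]
        linarith
  · obtain ⟨i, -, hi⟩ := Finset.exists_mem_eq_inf' (hne K) (f K)
    refine ⟨i, fun a => ?_⟩
    have hl := hlog K hK
    have hl0 : 0 < Real.log (2 + K) := by linarith
    have hll : Real.log (Real.log (2 + K)) ≠ 0 := (Real.log_pos hl).ne'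
    simp only [hi]
    simp only [hf]
    rw [← add_assoc, Real.rpow_add hl0 (a + _), mul_comm]
    congr 1
    rw [Real.rpow_def_of_pos hl0, mul_div_cancel₀ _ hll, Real.exp_log (by linarith [hC i])]

end SetAddition

theorem mainTheorem3 :
    ∃ (C : ℝ) (ε : ℝ → ℝ), 0 < C ∧ Tendsto ε atTop (𝓝 0) ∧
      ∀ (G : Type*) [AddCommGroup G] [DecidableEq G] (K : ℝ) (A : Finset G),
        1 ≤ K → A.Nonempty → ((A + A).card : ℝ) ≤ K * (A.card : ℝ) →
        ∃ X : Finset G,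
          SetAddition.IsSymmNhd X ∧
          SetAddition.IsCoveredBy (Real.exp (C * Real.log (2 + K) ^ (3 + ε K))) A X ∧
          (X.card : ℝ) ≤ Real.exp (C * Real.log (2 + K) ^ (1 + ε K)) * (A.card : ℝ) ∧
          SetAddition.HasRelPolyGrowth (C * Real.log (2 + K) ^ (3 + ε K)) X := by
  have h : ∀ i : ℕ, (0 : ℝ) < 1 / ((i : ℝ) + 1) ∧ 1 / ((i : ℝ) + 1) ≤ 1 := fun i =>
    ⟨by positivity, div_le_one_of_le₀ (by linarith [Nat.cast_nonneg (α := ℝ) i]) (by positivity)⟩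
  choose C hC hmain using fun i => SetAddition.exists_relPolyGrowth (h i).1 (h i).2
  obtain ⟨ε, hε, hexp⟩ := SetAddition.exists_tendsto_zero_exponent C hC
  refine ⟨1, ε, one_pos, hε, fun G _ _ K A hK hA hAA => ?_⟩
  obtain ⟨i, hi⟩ := hexp K hK
  have hL : 1 ≤ Real.log (2 + K) := by
    rw [Real.le_log_iff_exp_le (by linarith)]
    linarith [Real.exp_one_lt_d9]
  obtain ⟨X, hX⟩ := hmain i G A (Real.log (2 + K)) hL hA (by
    rw [Real.exp_log (by linarith)]
    exact hAA.trans (mul_le_mul_of_nonneg_right (by linarith) (Nat.cast_nonneg _)))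
  rw [hi 3, hi 1] at hX
  exact ⟨X, by simpa only [one_mul] using hX⟩
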